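/- Let $\mathbb{B}=\{q\in\mathbb{H} : |q|<1\}$ be the open unit ball of the quaternions and $\mathbb{S}=\{I\in\mathbb{H} : I^2=-1\}$. A function $f:\mathbb{B}\to\mathbb{H}$ is slice regular if for every $I\in\mathbb{S}$ its restriction to $\mathbb{B}\cap(\mathbb{R}+I\mathbb{R})$ is real differentiable and $\frac12\left(\frac{\partial}{\partial x}+I\frac{\partial}{\partial y}\right)f(x+Iy)=0$ there. Such an $f$ has a unique expansion $f(q)=\sum_n q^n a_n$ in $\mathbb{B}$ with $a_n\in\mathbb{H}$. For $g(q)=\sum_n q^n b_n$ slice regular as well, put $$f*g(q)=\sum_n q^n\sum_{k=0}^n a_k b_{n-k},\qquad f^c(q)=\sum_n q^n\bar a_n,\qquad f^s=f*f^c,$$ and let $f^{-*}*g(q)=f^s(q)^{-1}\,(f^c*g)(q)$ for the $q\in\mathbb{B}$ with $f^s(q)\neq 0$. In formulas such as $\bar q_0*f(q)$, constants are regarded as constant functions and $q$ denotes the variable. For $q_0\in\mathbb{B}$ and $f$ slice regular, let - $\partial_c f(x+Iy)=\frac12\left(\frac{\partial}{\partial x}-I\frac{\partial}{\partial y}\right)f(x+Iy)$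 (Cullen derivative; $x,y\in\mathbb{R}$, $I\in\mathbb{S}$); - $\partial_s f(q_0)=(2\,\mathrm{Im}\,q_0)^{-1}\left(f(q_0)-f(\bar q_0)\right)$ if $q_0\notin\mathbb{R}$, and $\partial_s f(q_0)=\partial_c f(q_0)$ if $q_0\in\mathbb{R}$ (spherical derivative); - $R_{q_0}f(q)=(q-q_0)^{-*}*(f(q)-f(q_0))$, extended by continuity to all of $\mathbb{B}$ (differential quotient). Theorem. Let $f:\mathbb{B}\to\mathbb{B}$ be a slice regular function and suppose that $f$ has a fixed point $q_0\in\mathbb{B}$. The following facts are equivalent: 1. $f$ coincides with the identity function on $\mathbb{B}$; 2. $f$ is real differentiable at $q_0$ and its real differential at $q_0$ is the identity; 3. $\partial_c f(q_0)=1$; 4. $\partial_s f(q_0)=1$; 5. there is a $q\in\mathbb{B}$ at which $R_{q_0}f(q)=(1-\bar q_0*q)^{-*}*(1-\bar q_0*f(q))$. -/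

import Mathlib

open scoped Quaternion Topology

noncomputable section

namespace SliceRegular

/-- The open unit ball `𝔹` of the quaternions. -/
def unitBall : Set ℍ[ℝ] := Metric.ball 0 1

/-- The sphere `𝕊` of imaginary units. -/
def imaginaryUnits : Set ℍ[ℝ] := {I | I ^ 2 = -1}

/-- `∂f/∂x` at the point `x + I y` of the slice `ℝ + I ℝ`. -/
def partialX (f : ℍ[ℝ] → ℍ[ℝ]) (I : ℍ[ℝ]) (x y : ℝ) : ℍ[ℝ] :=
  deriv (fun s : ℝ => f ((s : ℍ[ℝ]) + I * (y : ℍ[ℝ]))) x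

/-- `∂f/∂y` at the point `x + I y` of the slice `ℝ + I ℝ`. -/
def partialY (f : ℍ[ℝ] → ℍ[ℝ]) (I : ℍ[ℝ]) (x y : ℝ) : ℍ[ℝ] :=
  deriv (fun t : ℝ => f ((x : ℍ[ℝ]) + I * (t : ℍ[ℝ]))) y

/-- Slice regularity of `f` on an open set `Ω`: for every imaginary unit `I`, the restriction
of `f` to `Ω ∩ (ℝ + I ℝ)` is real differentiable and `(1/2) (∂/∂x + I ∂/∂y) f` vanishes there. -/
def SliceRegularOn (f : ℍ[ℝ] → ℍ[ℝ]) (Ω : Set ℍ[ℝ]) : Prop :=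
  ∀ I ∈ imaginaryUnits, ∀ x y : ℝ, (x : ℍ[ℝ]) + I * (y : ℍ[ℝ]) ∈ Ω →
    DifferentiableAt ℝ (fun p : ℝ × ℝ => f ((p.1 : ℍ[ℝ]) + I * (p.2 : ℍ[ℝ]))) (x, y) ∧
    (1 / 2 : ℝ) • (partialX f I x y + I * partialY f I x y) = 0

/-- The imaginary unit `i`. -/
def unitI : ℍ[ℝ] := ⟨0, 1, 0, 0⟩

/-- An imaginary unit `I` with `q = Re q + I |Im q|`; the unit `i` is taken when `q` is real. -/
def unitOf (q : ℍ[ℝ]) : ℍ[ℝ] :=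
  open Classical in if q.im = 0 then unitI else (‖q.im‖⁻¹ : ℝ) • q.im

/-- The Cullen derivative `∂_c f (x + I y) = (1/2) (∂/∂x - I ∂/∂y) f (x + I y)`. For slice regular
`f` it does not depend on how `q` is written as `x + I y`, see `cullenDeriv_eq`. -/
def cullenDeriv (f : ℍ[ℝ] → ℍ[ℝ]) (q : ℍ[ℝ]) : ℍ[ℝ] :=
  (1 / 2 : ℝ) •
    (partialX f (unitOf q) q.re ‖q.im‖ - unitOf q * partialY f (unitOf q) q.re ‖q.im‖)

/-- The spherical derivative `∂_s f (q) = (2 Im q)⁻¹ (f q - f (conj q))`; at a real point, where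
this quotient has no meaning, its value is the Cullen derivative, which is the limit of the
quotients when `f` is slice regular. -/
def sphericalDeriv (f : ℍ[ℝ] → ℍ[ℝ]) (q : ℍ[ℝ]) : ℍ[ℝ] :=
  open Classical in
  if q.im = 0 then cullenDeriv f q else (2 * q.im)⁻¹ * (f q - f (star q))

/-- `f(q) = ∑ qⁿ aₙ` in the unit ball. -/
def HasExpansion (f : ℍ[ℝ] → ℍ[ℝ]) (a : ℕ → ℍ[ℝ]) : Prop :=
  ∀ q ∈ unitBall, HasSum (fun n => q ^ n * a n) (f q)

/-- The power series `∑ tⁿ cₙ` of a real variable `t`; it serves only to show that the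
coefficients of an expansion are unique. -/
def realSeries (c : ℕ → ℍ[ℝ]) : FormalMultilinearSeries ℝ ℝ ℍ[ℝ] :=
  fun n => ContinuousMultilinearMap.mkPiRing ℝ (Fin n) (c n)

theorem HasExpansion.unique {f : ℍ[ℝ] → ℍ[ℝ]} {a b : ℕ → ℍ[ℝ]}
    (ha : HasExpansion f a) (hb : HasExpansion f b) : a = b := by
  have key : ∀ c : ℕ → ℍ[ℝ], HasExpansion f c →
      HasFPowerSeriesAt (fun t : ℝ => f (t : ℍ[ℝ])) (realSeries c) 0 := by
    intro c hc
    rw [hasFPowerSeriesAt_iff]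
    filter_upwards [Metric.ball_mem_nhds (0 : ℝ) one_pos] with t ht
    have h1 : (t : ℍ[ℝ]) ∈ unitBall := by
      simpa [unitBall, Metric.mem_ball] using ht
    have h2 := hc _ h1
    have h3 : (fun n => t ^ n • (realSeries c).coeff n) = fun n => (t : ℍ[ℝ]) ^ n * c n := by
      funext n
      simp [realSeries, FormalMultilinearSeries.coeff, ← Quaternion.coe_pow,
        Quaternion.coe_mul_eq_smul]
    rw [h3, zero_add]
    exact h2
  have h := (key a ha).eq_formalMultilinearSeries (key b hb)
  funext n
  have h3 := congrArg (fun p : FormalMultilinearSeries ℝ ℝ ℍ[ℝ] => p.coeff n) h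
  simpa [realSeries, FormalMultilinearSeries.coeff] using h3

/-- The coefficients `aₙ` of `f(q) = ∑ qⁿ aₙ`; junk value `0` without such an expansion. -/
def coeff (f : ℍ[ℝ] → ℍ[ℝ]) : ℕ → ℍ[ℝ] :=
  open Classical in if h : ∃ a, HasExpansion f a then h.choose else 0

theorem coeff_eq {f : ℍ[ℝ] → ℍ[ℝ]} {a : ℕ → ℍ[ℝ]} (h : HasExpansion f a) : coeff f = a := by
  have h' : ∃ a, HasExpansion f a := ⟨a, h⟩
  rw [coeff, dif_pos h']
  exact h'.choose_spec.unique h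

/-- The regular product `f * g (q) = ∑ qⁿ ∑_{k ≤ n} a_k b_{n-k}` on the unit ball. -/
def regMul (f g : ℍ[ℝ] → ℍ[ℝ]) (q : ℍ[ℝ]) : ℍ[ℝ] :=
  ∑' n : ℕ, q ^ n * ∑ k ∈ Finset.range (n + 1), coeff f k * coeff g (n - k)

/-- The regular conjugate `f^c(q) = ∑ qⁿ conj(aₙ)`. -/
def regConj (f : ℍ[ℝ] → ℍ[ℝ]) (q : ℍ[ℝ]) : ℍ[ℝ] :=
  ∑' n : ℕ, q ^ n * star (coeff f n)

/-- The symmetrization `f^s = f * f^c`. -/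
def regSymm (f : ℍ[ℝ] → ℍ[ℝ]) : ℍ[ℝ] → ℍ[ℝ] := regMul f (regConj f)

/-- The domain of definition `𝔹 ∖ Z(f^s)` of the left regular quotients with denominator `f`. -/
def quotientDomain (f : ℍ[ℝ] → ℍ[ℝ]) : Set ℍ[ℝ] := {q | q ∈ unitBall ∧ regSymm f q ≠ 0}

/-- The left regular quotient `f^{-*} * g (q) = f^s(q)⁻¹ (f^c * g)(q)`; it is meaningful for `q`
in `quotientDomain f`. -/
def leftQuotient (f g : ℍ[ℝ] → ℍ[ℝ]) (q : ℍ[ℝ]) : ℍ[ℝ] :=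
  (regSymm f q)⁻¹ * regMul (regConj f) g q

/-- The differential quotient `R_{q₀} f (q) = (q - q₀)^{-*} * (f(q) - f(q₀))`, as a function on the
whole unit ball: `extendFrom` extends the quotient by continuity from its domain of definition to
the sphere `{x + y I : I ∈ 𝕊}` through `q₀ = x + y I₀`. -/
def diffQuotient (f : ℍ[ℝ] → ℍ[ℝ]) (q₀ : ℍ[ℝ]) : ℍ[ℝ] → ℍ[ℝ] :=
  extendFrom (quotientDomain fun q => q - q₀) (leftQuotient (fun q => q - q₀) fun q => f q - f q₀)

theorem cullenDeriv_eq {f : ℍ[ℝ] → ℍ[ℝ]} {Ω : Set ℍ[ℝ]} (hf : SliceRegularOn f Ω)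
    {I : ℍ[ℝ]} (hI : I ∈ imaginaryUnits) {x y : ℝ} (hxy : (x : ℍ[ℝ]) + I * (y : ℍ[ℝ]) ∈ Ω) :
    cullenDeriv f ((x : ℍ[ℝ]) + I * (y : ℍ[ℝ])) =
      (1 / 2 : ℝ) • (partialX f I x y - I * partialY f I x y) := by
  have hI2 : I * I = -1 := by rw [← sq]; exact hI
  have hIre : I.re = 0 ∧ ‖I‖ = 1 := by
    have hn : ‖I‖ = 1 := by
      have h1 : ‖I‖ * ‖I‖ = 1 := by rw [← norm_mul, hI2]; simp
      nlinarith [norm_nonneg I]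
    refine ⟨?_, hn⟩
    have e1 := congrArg QuaternionAlgebra.re hI2
    have e2 : I.re ^ 2 + I.imI ^ 2 + I.imJ ^ 2 + I.imK ^ 2 = 1 := by
      rw [← Quaternion.normSq_def', Quaternion.normSq_eq_norm_mul_self, hn]; norm_num
    simp at e1
    nlinarith
  obtain ⟨h0, hn⟩ := hIre
  have him : I.im = I := by ext <;> simp [h0]
  have hre : ((x : ℍ[ℝ]) + I * (y : ℍ[ℝ])).re = x := by simp [h0]
  have him' : ((x : ℍ[ℝ]) + I * (y : ℍ[ℝ])).im = y • I := by
    rw [Quaternion.mul_coe_eq_smul]; ext <;> simp [h0]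
  have hnorm : ‖((x : ℍ[ℝ]) + I * (y : ℍ[ℝ])).im‖ = |y| := by
    rw [him', norm_smul, hn]; simp
  have hI0 : I ≠ 0 := by rintro rfl; simp at hn
  rcases lt_trichotomy y 0 with hy | hy | hy
  · have hu : unitOf ((x : ℍ[ℝ]) + I * (y : ℍ[ℝ])) = -I := by
      rw [unitOf, if_neg (by rw [him']; simp [hy.ne, hI0]), hnorm, him', smul_smul,
        abs_of_neg hy, inv_neg, neg_mul, inv_mul_cancel₀ hy.ne]; simp
    rw [cullenDeriv, hu, hre, hnorm, abs_of_neg hy]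
    have hX : partialX f (-I) x (-y) = partialX f I x y := by
      simp [partialX]
    have hY : partialY f (-I) x (-y) = -partialY f I x y := by
      have := deriv_comp_neg (fun t : ℝ => f ((x : ℍ[ℝ]) + I * (t : ℍ[ℝ]))) (-y)
      simpa [partialY] using this
    rw [hX, hY, neg_mul_neg]
  · subst hy
    have hu : unitOf ((x : ℍ[ℝ]) + I * ((0 : ℝ) : ℍ[ℝ])) = unitI := by
      rw [unitOf, if_pos (by rw [him']; simp)]
    have hi' : unitI ∈ imaginaryUnits := by
      have c0 : unitI.re = 0 := rfl
      have c1 : unitI.imI = 1 := rfl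
      have c2 : unitI.imJ = 0 := rfl
      have c3 : unitI.imK = 0 := rfl
      change unitI ^ 2 = -1
      rw [sq]; ext <;> simp [c0, c1, c2, c3]
    rw [cullenDeriv, hu, hre, hnorm, abs_zero]
    have a1 := (hf I hI x 0 hxy).2
    have a2 := (hf unitI hi' x 0 (by simpa using hxy)).2
    have hX : partialX f unitI x 0 = partialX f I x 0 := by simp [partialX]
    have two : (1 / 2 : ℝ) ≠ 0 := by norm_num
    have b1 := (smul_eq_zero.mp a1).resolve_left two
    have b2 := (smul_eq_zero.mp a2).resolve_left two
    rw [eq_neg_of_add_eq_zero_right b1, eq_neg_of_add_eq_zero_right b2, hX]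
  · have hu : unitOf ((x : ℍ[ℝ]) + I * (y : ℍ[ℝ])) = I := by
      rw [unitOf, if_neg (by rw [him']; simp [hy.ne', hI0]), hnorm, him', smul_smul,
        abs_of_pos hy, inv_mul_cancel₀ hy.ne', one_smul]
    rw [cullenDeriv, hu, hre, hnorm, abs_of_pos hy]

end SliceRegular

end

/-! Write `a` for the fixed point and divide: `f(q) = q + (q - a) * k(q)`, so that `k = R_a f - 1`.
Each of conditions 3, 4 and 5 says that `k` vanishes at some point of the ball: `∂_c f(a) = 1 +
k(a)`; for non-real `a`, `∂_s f(a) = 1` means `f(ā) = ā`, that is `k(ā) = 0`; and equality in 5 at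
`q` gives a zero of `k` at a conjugate of `q`. Condition 2 lies between 1 and 3. Everything thus
rests on one rigidity statement, `eq_zero_of_twistedEval_eq_zero_of_bounded`: as `|f| ≤ 1`, a single
zero of `k` forces `k = 0`.

Regular products are handled by the operators `A_q(w) = ∑ qⁿ w aₙ`. They satisfy `(A * B)_q = B_q ∘
A_q` (`twistedEval_mul`), and since `A_q(w) = w A(w⁻¹qw)`, a bound for `A` on the ball bounds the
operator norm of `A_q`. In these terms `f_q(w) = qw + k_q(qw - wa)`.

For rigidity, fix `w ≠ 0`, let `z` run through the complex unit disc, and put `κ(z) = k_z(w)`. Let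
`x` solve the Stein equation `x - z̄ x a = w`. Up to errors of order `1 - |z|²`, `f_z(z̄x)` equals
`x + κ`, so `|x + κ| ≤ |x| + O(1 - |z|²)`, whence `|κ|² + 2 Re(κ x̄) ≤ O(1 - |z|²)` near the circle
(`norm_sq_add_steinPairing_le`). Because `x` is antiholomorphic in `z`, `Re(κ x̄)` is the real part
of a holomorphic `P`. The maximum principle for `exp P` gives `Re P ≤ 0`; a zero of `κ` makes `Re P`
attain `0`, so `Re P` vanishes identically. Then `|κ|² ≤ O(1 - |z|²)`, and the maximum principle
applied to the coordinates of `κ` gives `κ = 0`. -/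

open PowerSeries (X C)
open Quaternion (coeComplex)

noncomputable section

namespace SliceRegular

/-! ### Power series on the ball and their twisted evaluation -/

section

/-- The coefficients of `A` satisfy the growth condition that makes `∑ qⁿ aₙ` converge absolutely
in the unit ball. -/
def ConvergesOnBall (A : PowerSeries ℍ[ℝ]) : Prop :=
  ∀ r : ℝ, 0 ≤ r → r < 1 → Summable fun n => r ^ n * ‖PowerSeries.coeff n A‖

/-- The sum `∑ qⁿ w aₙ`. For `w ≠ 0` it is `w A(w⁻¹ q w)`; the operators `w ↦ ∑ qⁿ w aₙ` turn the
regular product into composition. -/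
def twistedEval (A : PowerSeries ℍ[ℝ]) (q w : ℍ[ℝ]) : ℍ[ℝ] :=
  ∑' n, q ^ n * w * PowerSeries.coeff n A

theorem norm_twisted_term (A : PowerSeries ℍ[ℝ]) (q w : ℍ[ℝ]) (n : ℕ) :
    ‖q ^ n * w * PowerSeries.coeff n A‖ = ‖w‖ * (‖q‖ ^ n * ‖PowerSeries.coeff n A‖) := by
  rw [norm_mul, norm_mul, norm_pow]; ring

namespace ConvergesOnBall

variable {A B : PowerSeries ℍ[ℝ]}

theorem summable_norm (hA : ConvergesOnBall A) {q : ℍ[ℝ]} (hq : ‖q‖ < 1) (w : ℍ[ℝ]) :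
    Summable fun n => ‖q ^ n * w * PowerSeries.coeff n A‖ := by
  simp_rw [norm_twisted_term]
  exact (hA _ (norm_nonneg q) hq).mul_left _

theorem summable (hA : ConvergesOnBall A) {q : ℍ[ℝ]} (hq : ‖q‖ < 1) (w : ℍ[ℝ]) :
    Summable fun n => q ^ n * w * PowerSeries.coeff n A :=
  (hA.summable_norm hq w).of_norm

theorem hasSum (hA : ConvergesOnBall A) {q : ℍ[ℝ]} (hq : ‖q‖ < 1) (w : ℍ[ℝ]) :
    HasSum (fun n => q ^ n * w * PowerSeries.coeff n A) (twistedEval A q w) :=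
  (hA.summable hq w).hasSum

theorem of_norm_le (hA : ConvergesOnBall A)
    (h : ∀ n, ‖PowerSeries.coeff n B‖ ≤ ‖PowerSeries.coeff n A‖) : ConvergesOnBall B := by
  intro r h0 h1
  refine (hA r h0 h1).of_nonneg_of_le (fun n => by positivity) fun n => ?_
  gcongr
  exact h n

theorem add (hA : ConvergesOnBall A) (hB : ConvergesOnBall B) : ConvergesOnBall (A + B) := by
  intro r h0 h1
  refine ((hA r h0 h1).add (hB r h0 h1)).of_nonneg_of_le (fun n => by positivity) fun n => ?_
  rw [← mul_add, map_add]
  gcongr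
  exact norm_add_le _ _

theorem neg (hA : ConvergesOnBall A) : ConvergesOnBall (-A) :=
  hA.of_norm_le fun n => by simp

theorem sub (hA : ConvergesOnBall A) (hB : ConvergesOnBall B) : ConvergesOnBall (A - B) := by
  rw [sub_eq_add_neg]; exact hA.add hB.neg

theorem of_finite (N : ℕ) (h : ∀ n, N ≤ n → PowerSeries.coeff n A = 0) : ConvergesOnBall A := by
  intro r _ _
  refine summable_of_hasFiniteSupport ((Set.finite_lt_nat N).subset fun n hn => ?_)
  by_contra hc
  simp only [Set.mem_ofPred_eq, not_lt] at hc
  exact hn (by simp [h n hc])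

theorem const (c : ℍ[ℝ]) : ConvergesOnBall (C c) :=
  of_finite 1 fun n hn => by
    rw [PowerSeries.coeff_C, if_neg (by omega)]

theorem one : ConvergesOnBall 1 := by
  simpa using const 1

theorem X : ConvergesOnBall (PowerSeries.X) :=
  of_finite 2 fun n hn => by
    rw [PowerSeries.coeff_X, if_neg (by omega)]

theorem summable_prod (hA : ConvergesOnBall A) (hB : ConvergesOnBall B) {q : ℍ[ℝ]} (hq : ‖q‖ < 1)
    (w : ℍ[ℝ]) :
    Summable fun p : ℕ × ℕ =>
      ‖q ^ p.2 * (q ^ p.1 * w * PowerSeries.coeff p.1 A) * PowerSeries.coeff p.2 B‖ := by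
  refine ((hA.summable_norm hq w).mul_of_nonneg (hB.summable_norm hq 1)
    (fun _ => norm_nonneg _) (fun _ => norm_nonneg _)).congr fun p => ?_
  simp only [norm_mul, norm_pow, norm_one]
  ring

theorem twisted_coeff_mul (A B : PowerSeries ℍ[ℝ]) (q w : ℍ[ℝ]) (n : ℕ) :
    q ^ n * w * PowerSeries.coeff n (A * B) = ∑ p ∈ Finset.HasAntidiagonal.antidiagonal n,
      q ^ p.2 * (q ^ p.1 * w * PowerSeries.coeff p.1 A) * PowerSeries.coeff p.2 B := by
  rw [PowerSeries.coeff_mul, Finset.mul_sum]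
  refine Finset.sum_congr rfl fun p hp => ?_
  rw [← Finset.HasAntidiagonal.mem_antidiagonal.mp hp, add_comm, pow_add]
  simp only [mul_assoc]

theorem mul (hA : ConvergesOnBall A) (hB : ConvergesOnBall B) : ConvergesOnBall (A * B) := by
  intro r h0 h1
  have h := summable_norm_sum_mul_antidiagonal_of_summable_norm
    (f := fun n => r ^ n * ‖PowerSeries.coeff n A‖) (g := fun n => r ^ n * ‖PowerSeries.coeff n B‖)
    (hA r h0 h1).norm (hB r h0 h1).norm
  refine h.of_nonneg_of_le (fun n => by positivity) fun n => ?_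
  refine le_trans ?_ (le_abs_self _)
  rw [PowerSeries.coeff_mul]
  refine (mul_le_mul_of_nonneg_left (norm_sum_le _ _) (by positivity)).trans ?_
  rw [Finset.mul_sum]
  refine Finset.sum_le_sum fun p hp => ?_
  rw [← Finset.HasAntidiagonal.mem_antidiagonal.mp hp, norm_mul, pow_add]
  exact le_of_eq (by ring)

end ConvergesOnBall

variable {A B : PowerSeries ℍ[ℝ]} {q : ℍ[ℝ]}

/-- One absolutely convergent double series is summed in two ways: along antidiagonals it gives the
product, and with the exponent of `B` fixed it gives the iterated evaluation. The left factor acts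
first. -/
theorem twistedEval_mul (hA : ConvergesOnBall A) (hB : ConvergesOnBall B) (hq : ‖q‖ < 1)
    (w : ℍ[ℝ]) : twistedEval (A * B) q w = twistedEval B q (twistedEval A q w) := by
  have hs := (hA.summable_prod hB hq w).of_norm
  have h1 : HasSum (fun p : ℕ × ℕ =>
      q ^ p.2 * (q ^ p.1 * w * PowerSeries.coeff p.1 A) * PowerSeries.coeff p.2 B)
      (twistedEval (A * B) q w) := by
    have h2 := (Finset.HasAntidiagonal.sigmaAntidiagonalEquivProd.hasSum_iff).mpr hs.hasSum
    have h3 := h2.sigma (g := fun n => q ^ n * w * PowerSeries.coeff n (A * B)) fun n => by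
      rw [ConvergesOnBall.twisted_coeff_mul, ← Finset.sum_coe_sort]
      exact hasSum_fintype _
    rw [twistedEval, h3.tsum_eq]
    exact hs.hasSum
  have h4 : HasSum (fun p : ℕ × ℕ =>
      q ^ p.1 * (q ^ p.2 * w * PowerSeries.coeff p.2 A) * PowerSeries.coeff p.1 B)
      (twistedEval (A * B) q w) := (Equiv.prodComm ℕ ℕ).hasSum_iff.mpr h1
  have h5 := h4.prod_fiberwise fun m =>
    ((hA.hasSum hq w).mul_left (q ^ m)).mul_right (PowerSeries.coeff m B)
  exact h5.tsum_eq.symm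

theorem twistedEval_add_right (hA : ConvergesOnBall A) (hq : ‖q‖ < 1) (v w : ℍ[ℝ]) :
    twistedEval A q (v + w) = twistedEval A q v + twistedEval A q w := by
  rw [twistedEval, twistedEval, twistedEval, ← (hA.summable hq v).tsum_add (hA.summable hq w)]
  exact tsum_congr fun n => by rw [mul_add, add_mul]

/-- Such a `c` moves past every `qⁿ`. Symmetrizations have real coefficients, so their values at `q`
qualify, and this is how they cancel in regular quotients. -/
theorem twistedEval_commute_mul {c : ℍ[ℝ]} (hc : Commute c q) (w : ℍ[ℝ]) :
    twistedEval A q (c * w) = c * twistedEval A q w := by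
  rw [twistedEval, twistedEval, ← tsum_mul_left]
  refine tsum_congr fun n => ?_
  rw [← mul_assoc, ← (hc.pow_right n).eq]
  simp only [mul_assoc]

theorem twistedEval_zero_right (A : PowerSeries ℍ[ℝ]) (q : ℍ[ℝ]) : twistedEval A q 0 = 0 := by
  simp [twistedEval]

theorem twistedEval_sub_right (hA : ConvergesOnBall A) (hq : ‖q‖ < 1) (v w : ℍ[ℝ]) :
    twistedEval A q (v - w) = twistedEval A q v - twistedEval A q w := by
  rw [eq_sub_iff_add_eq, ← twistedEval_add_right hA hq, sub_add_cancel]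

theorem twistedEval_add (hA : ConvergesOnBall A) (hB : ConvergesOnBall B) (hq : ‖q‖ < 1)
    (w : ℍ[ℝ]) : twistedEval (A + B) q w = twistedEval A q w + twistedEval B q w := by
  rw [twistedEval, twistedEval, twistedEval, ← (hA.summable hq w).tsum_add (hB.summable hq w)]
  exact tsum_congr fun n => by rw [map_add, mul_add]

theorem twistedEval_sub (hA : ConvergesOnBall A) (hB : ConvergesOnBall B) (hq : ‖q‖ < 1)
    (w : ℍ[ℝ]) : twistedEval (A - B) q w = twistedEval A q w - twistedEval B q w := by
  rw [eq_sub_iff_add_eq, ← twistedEval_add (hA.sub hB) hB hq, sub_add_cancel]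

theorem twistedEval_C (c q w : ℍ[ℝ]) : twistedEval (C c) q w = w * c := by
  rw [twistedEval, tsum_eq_single 0 fun n hn => by rw [PowerSeries.coeff_C, if_neg hn, mul_zero]]
  simp

theorem twistedEval_one (q w : ℍ[ℝ]) : twistedEval 1 q w = w := by
  simpa using twistedEval_C 1 q w

theorem twistedEval_X (q w : ℍ[ℝ]) : twistedEval X q w = q * w := by
  rw [twistedEval, tsum_eq_single 1 fun n hn => by rw [PowerSeries.coeff_X, if_neg hn, mul_zero]]
  simp

theorem conj_pow_eq (q : ℍ[ℝ]) {w : ℍ[ℝ]} (hw : w ≠ 0) (n : ℕ) :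
    (w⁻¹ * q * w) ^ n = w⁻¹ * q ^ n * w := by
  induction n with
  | zero => simp [hw]
  | succ n ih =>
    rw [pow_succ, ih, pow_succ]
    simp only [mul_assoc, mul_inv_cancel_left₀ hw]

theorem twistedEval_eq_mul (A : PowerSeries ℍ[ℝ]) (q : ℍ[ℝ]) {w : ℍ[ℝ]} (hw : w ≠ 0) :
    twistedEval A q w = w * twistedEval A (w⁻¹ * q * w) 1 := by
  rw [twistedEval, twistedEval, ← tsum_mul_left]
  refine tsum_congr fun n => ?_
  rw [conj_pow_eq q hw, mul_one]
  simp only [← mul_assoc, mul_inv_cancel₀ hw, one_mul]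

theorem norm_conj_mul (q : ℍ[ℝ]) {w : ℍ[ℝ]} (hw : w ≠ 0) : ‖w⁻¹ * q * w‖ = ‖q‖ := by
  rw [norm_mul, norm_mul, norm_inv]
  field_simp [norm_ne_zero_iff.mpr hw]

theorem norm_twistedEval_le {M : ℝ} (h : ∀ p : ℍ[ℝ], ‖p‖ < 1 → ‖twistedEval A p 1‖ ≤ M)
    (hq : ‖q‖ < 1) (w : ℍ[ℝ]) : ‖twistedEval A q w‖ ≤ M * ‖w‖ := by
  rcases eq_or_ne w 0 with rfl | hw
  · simp [twistedEval_zero_right]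
  · rw [twistedEval_eq_mul A q hw, norm_mul, mul_comm]
    gcongr
    exact h _ (by rwa [norm_conj_mul q hw])

theorem continuousAt_twistedEval (hA : ConvergesOnBall A) (hq : ‖q‖ < 1) (w : ℍ[ℝ]) :
    ContinuousAt (fun p => twistedEval A p w) q := by
  obtain ⟨r, h1, h2⟩ := exists_between hq
  have hr := (norm_nonneg q).trans h1.le
  have hc : ContinuousOn (fun p => twistedEval A p w) (Metric.ball 0 r) := by
    refine continuousOn_tsum (u := fun n => ‖w‖ * (r ^ n * ‖PowerSeries.coeff n A‖))
      (fun n => by fun_prop) ((hA r hr h2).mul_left _) fun n p hp => ?_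
    rw [norm_twisted_term]
    have : ‖p‖ ≤ r := by simpa using (Metric.mem_ball.mp hp).le
    gcongr
  exact hc.continuousAt (Metric.isOpen_ball.mem_nhds (by simpa using h1))

theorem mem_unitBall {q : ℍ[ℝ]} : q ∈ unitBall ↔ ‖q‖ < 1 := by
  simp [unitBall]

/-- Boundedness at a slightly larger radius `s` gives domination by a geometric series of ratio `r /
s`. -/
theorem convergesOnBall_of_bounded
    (h : ∀ r : ℝ, 0 ≤ r → r < 1 → ∃ M, ∀ n, r ^ n * ‖PowerSeries.coeff n A‖ ≤ M) :
    ConvergesOnBall A := by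
  intro r h0 h1
  obtain ⟨s, hrs, hs⟩ := exists_between h1
  have hs0 : 0 < s := h0.trans_lt hrs
  obtain ⟨M, hM⟩ := h s hs0.le hs
  have hg := (summable_geometric_of_lt_one (div_nonneg h0 hs0.le)
    ((div_lt_one hs0).mpr hrs)).mul_left M
  refine hg.of_nonneg_of_le (fun n => by positivity) fun n => ?_
  have h3 : r ^ n * ‖PowerSeries.coeff n A‖ = (s ^ n * ‖PowerSeries.coeff n A‖) * (r / s) ^ n := by
    rw [div_pow]; field_simp
  rw [h3]
  gcongr
  exact hM n

/-- `f` is the sum of the power series `A` in the unit ball. -/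
def HasPowerSeries (f : ℍ[ℝ] → ℍ[ℝ]) (A : PowerSeries ℍ[ℝ]) : Prop :=
  HasExpansion f fun n => PowerSeries.coeff n A

namespace HasPowerSeries

variable {f g : ℍ[ℝ] → ℍ[ℝ]}

theorem convergesOnBall (h : HasPowerSeries f A) : ConvergesOnBall A := by
  refine convergesOnBall_of_bounded fun r h0 h1 => ?_
  have hs := (h (r : ℍ[ℝ]) (by rw [mem_unitBall]; simpa [abs_of_nonneg h0] using h1)).summable
  obtain ⟨M, hM⟩ := (hs.tendsto_atTop_zero.norm).bddAbove_range
  refine ⟨M, fun n => ?_⟩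
  have := hM (Set.mem_range_self n)
  simpa [abs_of_nonneg h0] using this

theorem eq_twistedEval (h : HasPowerSeries f A) (hq : ‖q‖ < 1) : f q = twistedEval A q 1 := by
  have := h q (mem_unitBall.mpr hq)
  rw [twistedEval, ← this.tsum_eq]
  simp

theorem of_eq (hA : ConvergesOnBall A) (h : ∀ q : ℍ[ℝ], ‖q‖ < 1 → f q = twistedEval A q 1) :
    HasPowerSeries f A := by
  intro q hq
  rw [mem_unitBall] at hq
  rw [h q hq]
  simpa using hA.hasSum hq 1

theorem coeff_eq (h : HasPowerSeries f A) : coeff f = fun n => PowerSeries.coeff n A :=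
  SliceRegular.coeff_eq h

theorem regMul_eq (hf : HasPowerSeries f A) (hg : HasPowerSeries g B) (q : ℍ[ℝ]) :
    regMul f g q = twistedEval (A * B) q 1 := by
  rw [regMul, twistedEval, hf.coeff_eq, hg.coeff_eq]
  refine tsum_congr fun n => ?_
  rw [PowerSeries.coeff_mul, mul_one, Finset.Nat.sum_antidiagonal_eq_sum_range_succ_mk]

theorem regMul (hf : HasPowerSeries f A) (hg : HasPowerSeries g B) :
    HasPowerSeries (regMul f g) (A * B) :=
  of_eq (hf.convergesOnBall.mul hg.convergesOnBall) fun q _ => hf.regMul_eq hg q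

theorem regConj (hf : HasPowerSeries f A) (h : ∀ n, PowerSeries.coeff n B = star (PowerSeries.coeff n A)) :
    HasPowerSeries (regConj f) B := by
  refine of_eq (hf.convergesOnBall.of_norm_le fun n => by rw [h, norm_star]) fun q _ => ?_
  rw [SliceRegular.regConj, twistedEval, hf.coeff_eq]
  simp [h]

theorem sub (hf : HasPowerSeries f A) (hg : HasPowerSeries g B) :
    HasPowerSeries (fun q => f q - g q) (A - B) :=
  of_eq (hf.convergesOnBall.sub hg.convergesOnBall) fun q hq => by
    rw [twistedEval_sub hf.convergesOnBall hg.convergesOnBall hq, ← hf.eq_twistedEval hq,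
      ← hg.eq_twistedEval hq]

theorem const (c : ℍ[ℝ]) : HasPowerSeries (fun _ => c) (C c) :=
  of_eq (.const c) fun q _ => by rw [twistedEval_C, one_mul]

theorem id : HasPowerSeries (fun q => q) X :=
  of_eq .X fun q _ => by rw [twistedEval_X, mul_one]

end HasPowerSeries

end

/-! ### Left division by `q - a` and regular quotients -/

section

variable {A K : PowerSeries ℍ[ℝ]} {a q : ℍ[ℝ]}

theorem coeff_succ_X_sub_C_mul (a : ℍ[ℝ]) (K : PowerSeries ℍ[ℝ]) (n : ℕ) :
    PowerSeries.coeff (n + 1) ((X - C a) * K) =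
      PowerSeries.coeff n K - a * PowerSeries.coeff (n + 1) K := by
  rw [sub_mul, map_sub]
  exact congrArg₂ (· - ·) (PowerSeries.coeff_succ_X_mul n K) (PowerSeries.coeff_C_mul (n + 1) K a)

/-- A power series that vanishes at `a` has the left factor `q - a`. -/
theorem exists_eq_X_sub_C_mul (hA : ConvergesOnBall A) (ha : ‖a‖ < 1)
    (h0 : twistedEval A a 1 = 0) : ∃ K, ConvergesOnBall K ∧ A = (X - C a) * K := by
  have bound : ∀ s : ℝ, ‖a‖ ≤ s → ∀ n m : ℕ, s ^ (n + 1) * ‖a ^ m * PowerSeries.coeff (n + 1 + m) A‖ ≤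
      s ^ (m + (n + 1)) * ‖PowerSeries.coeff (m + (n + 1)) A‖ := by
    intro s hs n m
    have hs0 := (norm_nonneg a).trans hs
    rw [norm_mul, norm_pow, add_comm (n + 1) m, add_comm m (n + 1), pow_add s (n + 1) m, mul_assoc]
    gcongr
  have hsum : ∀ n, Summable fun m => ‖a ^ m * PowerSeries.coeff (n + 1 + m) A‖ := by
    intro n
    obtain ⟨s, h1, h2⟩ := exists_between ha
    have hs0 : 0 < s := (norm_nonneg a).trans_lt h1
    refine (summable_mul_left_iff (pow_ne_zero (n + 1) hs0.ne')).mp ?_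
    exact ((summable_nat_add_iff (n + 1)).mpr (hA s hs0.le h2)).of_nonneg_of_le
      (fun m => by positivity) (bound s h1.le n)
  -- Synthetic division from the top: unrolling `kₙ = Aₙ₊₁ + a kₙ₊₁` gives this series. The
  -- vanishing at `a` is needed only for the constant coefficient.
  let k : ℕ → ℍ[ℝ] := fun n => ∑' m, a ^ m * PowerSeries.coeff (n + 1 + m) A
  have hk : ∀ n, k n = PowerSeries.coeff (n + 1) A + a * k (n + 1) := by
    intro n
    simp only [k]
    rw [(hsum n).of_norm.tsum_eq_zero_add, ← tsum_mul_left]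
    simp only [pow_zero, one_mul, add_zero]
    congr 1
    refine tsum_congr fun m => ?_
    rw [pow_succ', mul_assoc, add_assoc (n + 1), add_comm m 1]
  have hk0 : PowerSeries.coeff 0 A = -(a * k 0) := by
    rw [twistedEval, (hA.summable ha 1).tsum_eq_zero_add] at h0
    simp only [pow_zero, one_mul, mul_one] at h0
    rw [eq_neg_iff_add_eq_zero, ← h0]
    simp only [k]
    rw [← tsum_mul_left]
    congr 1
    refine tsum_congr fun m => ?_
    rw [pow_succ', mul_assoc, zero_add, add_comm 1 m]
  refine ⟨PowerSeries.mk k, convergesOnBall_of_bounded fun r hr0 hr1 => ?_, ?_⟩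
  -- The radius `s` must exceed both `r` and `‖a‖`, so that the powers of `a` are absorbed by powers
  -- of `s`.
  · obtain ⟨s, h1, h2⟩ := exists_between (max_lt hr1 ha)
    have hs0 : 0 < s := hr0.trans_lt ((le_max_left _ _).trans_lt h1)
    refine ⟨s⁻¹ * ∑' n, s ^ n * ‖PowerSeries.coeff n A‖, fun n => ?_⟩
    rw [PowerSeries.coeff_mk, le_inv_mul_iff₀ hs0]
    calc s * (r ^ n * ‖k n‖) ≤ s * (s ^ n * ∑' m, ‖a ^ m * PowerSeries.coeff (n + 1 + m) A‖) := by
          gcongr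
          · exact ((le_max_left _ _).trans_lt h1).le
          · exact norm_tsum_le_tsum_norm (hsum n)
      _ = ∑' m, s ^ (n + 1) * ‖a ^ m * PowerSeries.coeff (n + 1 + m) A‖ := by
          rw [tsum_mul_left]; ring
      _ ≤ ∑' m, s ^ (m + (n + 1)) * ‖PowerSeries.coeff (m + (n + 1)) A‖ :=
          ((hsum n).mul_left _).tsum_le_tsum (bound s ((le_max_right _ _).trans_lt h1).le n)
            ((summable_nat_add_iff (n + 1)).mpr (hA s hs0.le h2))
      _ ≤ ∑' n, s ^ n * ‖PowerSeries.coeff n A‖ := by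
          rw [← (hA s hs0.le h2).sum_add_tsum_nat_add (n + 1)]
          exact le_add_of_nonneg_left (Finset.sum_nonneg fun i _ => by positivity)
  · ext1 n
    cases n with
    | zero =>
      rw [sub_mul, map_sub, PowerSeries.coeff_zero_X_mul, PowerSeries.coeff_C_mul,
        PowerSeries.coeff_mk, zero_sub, hk0]
    | succ n =>
      rw [coeff_succ_X_sub_C_mul, PowerSeries.coeff_mk, PowerSeries.coeff_mk, hk n, add_sub_cancel_right]

theorem twistedEval_X_sub_C_mul (hK : ConvergesOnBall K) (hq : ‖q‖ < 1) (a w : ℍ[ℝ]) :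
    twistedEval ((X - C a) * K) q w = twistedEval K q (q * w - w * a) := by
  rw [twistedEval_mul (.sub .X (.const a)) hK hq, twistedEval_sub .X (.const a) hq,
    twistedEval_X, twistedEval_C]

theorem twistedEval_one_sub_C_mul_X_mul (hK : ConvergesOnBall K) (hq : ‖q‖ < 1) (a w : ℍ[ℝ]) :
    twistedEval ((C 1 - C a * X) * K) q w = twistedEval K q (w - q * (w * a)) := by
  rw [twistedEval_mul (.sub (.const 1) (.mul (.const a) .X)) hK hq,
    twistedEval_sub (.const 1) (.mul (.const a) .X) hq, twistedEval_mul (.const a) .X hq,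
    twistedEval_X, twistedEval_C, twistedEval_C, mul_one]

theorem mul_sub_sub_mul_star (a q : ℍ[ℝ]) :
    q * (q - a) - (q - a) * star a =
      q * q - q * ((2 * a.re : ℝ) : ℍ[ℝ]) + ((Quaternion.normSq a : ℝ) : ℍ[ℝ]) := by
  rw [← Quaternion.self_mul_star, ← Quaternion.self_add_star']
  noncomm_ring

theorem one_sub_mul_sub_mul_star (a q : ℍ[ℝ]) :
    (1 - q * a) - q * ((1 - q * a) * star a) =
      1 - q * ((2 * a.re : ℝ) : ℍ[ℝ]) + q * q * ((Quaternion.normSq a : ℝ) : ℍ[ℝ]) := by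
  rw [← Quaternion.self_mul_star, ← Quaternion.self_add_star']
  noncomm_ring

/-- Taking norms, `|u| = |q| |u| |a|` with `|q| |a| < 1`. -/
theorem eq_zero_of_eq_mul_mul {a q u : ℍ[ℝ]} (ha : ‖a‖ < 1) (hq : ‖q‖ ≤ 1) (h : u - q * (u * a) = 0) :
    u = 0 := by
  by_contra hu
  have h1 : ‖u‖ = ‖q‖ * (‖u‖ * ‖a‖) := by
    rw [← norm_mul, ← norm_mul, ← sub_eq_zero.mp h]
  have h2 : 0 < ‖u‖ := norm_pos_iff.mpr hu
  nlinarith [norm_nonneg q, norm_nonneg a, mul_nonneg h2.le (norm_nonneg a)]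

theorem one_sub_mul_ne_zero (ha : ‖a‖ < 1) (hq : ‖q‖ ≤ 1) : 1 - q * a ≠ 0 := fun h =>
  one_ne_zero (eq_zero_of_eq_mul_mul (u := (1 : ℍ[ℝ])) ha hq (by rwa [one_mul]))

theorem commute_spherical (q : ℍ[ℝ]) (s t : ℝ) :
    Commute (q * q - q * (s : ℍ[ℝ]) + (t : ℍ[ℝ])) q :=
  (((Commute.refl q).mul_left (.refl q)).sub_left
    ((Commute.refl q).mul_left (Quaternion.coe_commutes s q))).add_left (Quaternion.coe_commutes t q)

theorem commute_spherical' (q : ℍ[ℝ]) (s t : ℝ) :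
    Commute (1 - q * (s : ℍ[ℝ]) + q * q * (t : ℍ[ℝ])) q :=
  ((Commute.one_left q).sub_left
    ((Commute.refl q).mul_left (Quaternion.coe_commutes s q))).add_left
    (((Commute.refl q).mul_left (.refl q)).mul_left (Quaternion.coe_commutes t q))

theorem coeff_C_star (a : ℍ[ℝ]) (n : ℕ) :
    PowerSeries.coeff n (C (star a)) = star (PowerSeries.coeff n (C a)) := by
  rw [PowerSeries.coeff_C, PowerSeries.coeff_C]; split_ifs <;> simp

theorem coeff_X_star (n : ℕ) :
    PowerSeries.coeff n (X : PowerSeries ℍ[ℝ]) = star (PowerSeries.coeff n X) := by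
  rw [PowerSeries.coeff_X]; split_ifs <;> simp

theorem hasPowerSeries_sub_const (a : ℍ[ℝ]) : HasPowerSeries (fun q => q - a) (X - C a) :=
  HasPowerSeries.id.sub (.const a)

theorem hasPowerSeries_regConj_sub_const (a : ℍ[ℝ]) :
    HasPowerSeries (regConj fun q => q - a) (X - C (star a)) :=
  (hasPowerSeries_sub_const a).regConj fun n => by
    rw [map_sub, map_sub, star_sub, coeff_C_star, ← coeff_X_star]

theorem regSymm_sub_const (a : ℍ[ℝ]) (hq : ‖q‖ < 1) :
    regSymm (fun q => q - a) q =
      q * q - q * ((2 * a.re : ℝ) : ℍ[ℝ]) + ((Quaternion.normSq a : ℝ) : ℍ[ℝ]) := by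
  rw [regSymm, (hasPowerSeries_sub_const a).regMul_eq (hasPowerSeries_regConj_sub_const a),
    twistedEval_X_sub_C_mul (.sub .X (.const _)) hq, twistedEval_sub .X (.const _) hq,
    twistedEval_X, twistedEval_C, mul_one, one_mul, mul_sub_sub_mul_star]

/-- Density is what makes the extension by continuity unique. A zero `q` of the symmetrization is
approached along real translates `q + t`, where the symmetrization changes by `t (2q + t - 2 Re a)`.
-/
theorem mem_closure_quotientDomain (a : ℍ[ℝ]) (hq : ‖q‖ < 1) :
    q ∈ closure (quotientDomain fun p => p - a) := by
  have hlim : Filter.Tendsto (fun t : ℝ => q + (t : ℍ[ℝ])) (𝓝[≠] 0) (𝓝 q) := by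
    have : Continuous fun t : ℝ => q + (t : ℍ[ℝ]) :=
      continuous_const.add Quaternion.continuous_coe
    simpa using (this.tendsto 0).mono_left nhdsWithin_le_nhds
  by_cases h : regSymm (fun p => p - a) q = 0
  swap
  · exact subset_closure ⟨mem_unitBall.mpr hq, h⟩
  refine mem_closure_of_tendsto hlim ?_
  have hball : ∀ᶠ t : ℝ in 𝓝[≠] 0, ‖q + (t : ℍ[ℝ])‖ < 1 :=
    hlim.norm.eventually_lt_const hq
  -- The real part of `2q + t - 2 Re a` vanishes only at `t = 2 Re a - 2 Re q`. That value is
  -- avoided when nonzero; when zero, it is already excluded by `t ≠ 0`.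
  have hne : ∀ᶠ t : ℝ in 𝓝[≠] 0, t ≠ 2 * a.re - 2 * q.re ∨ 2 * a.re - 2 * q.re = 0 := by
    by_cases hc : 2 * a.re - 2 * q.re = 0
    · exact Filter.Eventually.of_forall fun _ => Or.inr hc
    · exact (eventually_ne_nhds (Ne.symm hc)).filter_mono nhdsWithin_le_nhds |>.mono fun _ => Or.inl
  filter_upwards [hball, hne, self_mem_nhdsWithin] with t ht1 ht2 ht0
  refine ⟨mem_unitBall.mpr ht1, fun hz => ?_⟩
  rw [regSymm_sub_const a hq] at h
  rw [regSymm_sub_const a ht1] at hz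
  have ht0' : (t : ℍ[ℝ]) ≠ 0 := fun hc => ht0 (Quaternion.coe_injective hc)
  have h3 : (t : ℍ[ℝ]) * (q + q + (t : ℍ[ℝ]) - ((2 * a.re : ℝ) : ℍ[ℝ])) = 0 := by
    have hc := (Quaternion.coe_commutes t q)
    have : (q + (t : ℍ[ℝ])) * (q + (t : ℍ[ℝ])) - (q + (t : ℍ[ℝ])) * ((2 * a.re : ℝ) : ℍ[ℝ]) +
        ((Quaternion.normSq a : ℝ) : ℍ[ℝ]) -
        (q * q - q * ((2 * a.re : ℝ) : ℍ[ℝ]) + ((Quaternion.normSq a : ℝ) : ℍ[ℝ])) = 0 := by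
      rw [hz, h, sub_zero]
    rw [← this]
    simp only [mul_add, add_mul, mul_sub, hc]
    abel
  have h4 := congrArg QuaternionAlgebra.re ((mul_eq_zero.mp h3).resolve_left ht0')
  simp at h4
  rcases ht2 with h5 | h5
  · exact h5 (by linarith)
  · exact ht0 (by simp; linarith)

/-- Off the zeros of the symmetrization, the conjugate factor and `q - a` compose to multiplication
by its value, which the inverse cancels. The value elsewhere follows from continuity of the series.
-/
theorem diffQuotient_eq {f : ℍ[ℝ] → ℍ[ℝ]} {F G : PowerSeries ℍ[ℝ]} (hf : HasPowerSeries f F)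
    (hG : ConvergesOnBall G) (h : F - C (f a) = (X - C a) * G) (hq : ‖q‖ < 1) :
    diffQuotient f a q = twistedEval G q 1 := by
  refine extendFrom_eq (mem_closure_quotientDomain a hq) ?_
  refine ((continuousAt_twistedEval hG hq 1).tendsto.mono_left nhdsWithin_le_nhds).congr' ?_
  filter_upwards [self_mem_nhdsWithin] with p hp
  have hp1 := mem_unitBall.mp hp.1
  have hp2 := hp.2
  rw [leftQuotient, (hasPowerSeries_regConj_sub_const a).regMul_eq (hf.sub (.const _)), h,
    twistedEval_X_sub_C_mul (.mul (.sub .X (.const _)) hG) hp1, twistedEval_X_sub_C_mul hG hp1]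
  have e := mul_sub_sub_mul_star (star a) p
  rw [star_star, Quaternion.re_star, Quaternion.normSq_star, ← regSymm_sub_const a hp1] at e
  have hc : Commute (regSymm (fun q => q - a) p) p := by
    rw [regSymm_sub_const a hp1]; exact commute_spherical _ _ _
  rw [mul_one, one_mul, e]
  have e2 := twistedEval_commute_mul (A := G) hc 1
  rw [mul_one] at e2
  rw [e2, inv_mul_cancel_left₀ hp2]

/-- The numerator splits as `1 - āF = (1 - āX)(1 + K) - (1 - |a|²) K`. The denominator cancels in
the first term; the second is the exact defect between the two sides of condition 5. -/
theorem leftQuotient_eq {f : ℍ[ℝ] → ℍ[ℝ]} {F : PowerSeries ℍ[ℝ]} (hf : HasPowerSeries f F)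
    (ha : ‖a‖ < 1) (hK : ConvergesOnBall K) (h : F = X + (X - C a) * K) (hq : ‖q‖ < 1) :
    ∃ S : ℍ[ℝ], S ≠ 0 ∧ leftQuotient (fun p => 1 - regMul (fun _ => star a) (fun p => p) p)
      (fun p => 1 - regMul (fun _ => star a) f p) q =
    twistedEval (1 + K) q 1 - S⁻¹ * twistedEval K q ((1 - q * a) * (1 - star a * a)) := by
  have hu : HasPowerSeries (fun p => 1 - regMul (fun _ => star a) (fun p => p) p)
      (C 1 - C (star a) * X) := (HasPowerSeries.const 1).sub ((HasPowerSeries.const _).regMul .id)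
  have huc : HasPowerSeries (regConj fun p => 1 - regMul (fun _ => star a) (fun p => p) p)
      (C 1 - C a * X) := hu.regConj fun n => by
    rw [map_sub, map_sub, star_sub, PowerSeries.coeff_C_mul, PowerSeries.coeff_C_mul, star_mul,
      ← coeff_C_star, ← coeff_X_star, star_star, star_one, PowerSeries.coeff_X]
    split_ifs <;> simp
  have hv : HasPowerSeries (fun p => 1 - regMul (fun _ => star a) f p) (C 1 - C (star a) * F) :=
    (HasPowerSeries.const 1).sub ((HasPowerSeries.const _).regMul hf)
  have hG : ConvergesOnBall (1 + K) := .add .one hK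
  set S := regSymm (fun p => 1 - regMul (fun _ => star a) (fun p => p) p) q with hS
  have hS1 : S = (1 - q * star a) - q * ((1 - q * star a) * a) := by
    rw [hS, regSymm, hu.regMul_eq huc, twistedEval_one_sub_C_mul_X_mul huc.convergesOnBall hq,
      ← mul_one (C 1 - C a * X), twistedEval_one_sub_C_mul_X_mul .one hq, twistedEval_one, one_mul]
  have hS2 : S = (1 - q * a) - q * ((1 - q * a) * star a) := by
    have e := one_sub_mul_sub_mul_star (star a) q
    rw [star_star, Quaternion.re_star, Quaternion.normSq_star] at e
    rw [hS1, one_sub_mul_sub_mul_star, e]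
  have hS0 : S ≠ 0 := by
    intro h0
    exact one_sub_mul_ne_zero (by rwa [norm_star]) hq.le (eq_zero_of_eq_mul_mul ha hq.le (hS1 ▸ h0))
  have hSc : Commute S q := by
    rw [hS2, one_sub_mul_sub_mul_star]; exact commute_spherical' _ _ _
  have key : (C 1 - C a * X) * (C 1 - C (star a) * F) =
      (C 1 - C a * X) * ((C 1 - C (star a) * X) * (1 + K)) -
      (C 1 - C a * X) * (C (1 - star a * a) * K) := by
    rw [h, map_sub, map_mul, map_one]
    noncomm_ring
  refine ⟨S, hS0, ?_⟩
  rw [leftQuotient, huc.regMul_eq hv, key,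
    twistedEval_sub (huc.convergesOnBall.mul (hu.convergesOnBall.mul hG))
      (huc.convergesOnBall.mul (.mul (.const _) hK)) hq,
    twistedEval_one_sub_C_mul_X_mul (hu.convergesOnBall.mul hG) hq,
    twistedEval_one_sub_C_mul_X_mul hG hq, twistedEval_one_sub_C_mul_X_mul (.mul (.const _) hK) hq,
    twistedEval_mul (.const _) hK hq, twistedEval_C, one_mul, ← hS2, ← hS, mul_sub]
  congr 1
  have e2 := twistedEval_commute_mul (A := 1 + K) hSc 1
  rw [mul_one] at e2
  rw [e2, inv_mul_cancel_left₀ hS0]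

theorem diffQuotient_eq_one_add {f : ℍ[ℝ] → ℍ[ℝ]} {F : PowerSeries ℍ[ℝ]}
    (hf : HasPowerSeries f F) (hfa : f a = a) (hK : ConvergesOnBall K)
    (h : F = X + (X - C a) * K) (hq : ‖q‖ < 1) : diffQuotient f a q = twistedEval (1 + K) q 1 :=
  diffQuotient_eq hf (.add .one hK) (by rw [hfa, h]; noncomm_ring) hq

/-- A point of equality in the Schwarz–Pick inequality yields a zero of `R_a f - 1`. -/
theorem exists_twistedEval_eq_zero {f : ℍ[ℝ] → ℍ[ℝ]} {F : PowerSeries ℍ[ℝ]}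
    (hf : HasPowerSeries f F) (ha : ‖a‖ < 1) (hfa : f a = a) (hK : ConvergesOnBall K)
    (h : F = X + (X - C a) * K) (hq : ‖q‖ < 1)
    (heq : diffQuotient f a q =
      leftQuotient (fun p => 1 - regMul (fun _ => star a) (fun p => p) p)
        (fun p => 1 - regMul (fun _ => star a) f p) q) :
    ∃ p : ℍ[ℝ], ‖p‖ < 1 ∧ twistedEval K p 1 = 0 := by
  obtain ⟨S, hS, hl⟩ := leftQuotient_eq hf ha hK h hq
  rw [diffQuotient_eq_one_add hf hfa hK h hq, hl, eq_comm, sub_eq_self] at heq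
  have h0 := (mul_eq_zero.mp heq).resolve_left (inv_ne_zero hS)
  have he : (1 - q * a) * (1 - star a * a) ≠ 0 :=
    mul_ne_zero (one_sub_mul_ne_zero ha hq.le)
      (one_sub_mul_ne_zero ha (by rw [norm_star]; exact ha.le))
  rw [twistedEval_eq_mul K q he] at h0
  exact ⟨_, by rwa [norm_conj_mul q he], (mul_eq_zero.mp h0).resolve_left he⟩

end

/-! ### Complex coordinates and the maximum principle -/

section

/-- The first complex coordinate of `q = α + β j`. -/
def complexFst : ℍ[ℝ] →ₗ[ℝ] ℂ where
  toFun q := ⟨q.re, q.imI⟩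
  map_add' p q := by apply Complex.ext <;> simp
  map_smul' r q := by apply Complex.ext <;> simp

/-- The second complex coordinate of `q = α + β j`. -/
def complexSnd : ℍ[ℝ] →ₗ[ℝ] ℂ where
  toFun q := ⟨q.imJ, q.imK⟩
  map_add' p q := by apply Complex.ext <;> simp
  map_smul' r q := by apply Complex.ext <;> simp

theorem complexFst_coe_mul (z : ℂ) (q : ℍ[ℝ]) : complexFst (z * q) = z * complexFst q := by
  apply Complex.ext <;> simp [complexFst]

theorem complexSnd_coe_mul (z : ℂ) (q : ℍ[ℝ]) : complexSnd (z * q) = z * complexSnd q := by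
  apply Complex.ext <;> simp [complexSnd]

theorem re_complexFst (q : ℍ[ℝ]) : (complexFst q).re = q.re := rfl

theorem norm_sq_eq_complex (q : ℍ[ℝ]) :
    ‖q‖ ^ 2 = ‖complexFst q‖ ^ 2 + ‖complexSnd q‖ ^ 2 := by
  rw [sq, ← Quaternion.normSq_eq_norm_mul_self, Quaternion.normSq_def', ← Complex.normSq_eq_norm_sq,
    ← Complex.normSq_eq_norm_sq, Complex.normSq_apply, Complex.normSq_apply]
  simp only [complexFst, complexSnd, LinearMap.coe_mk, AddHom.coe_mk]
  ring

theorem norm_complexFst_le (q : ℍ[ℝ]) : ‖complexFst q‖ ≤ ‖q‖ := by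
  nlinarith [norm_sq_eq_complex q, norm_nonneg q, norm_nonneg (complexFst q), sq_nonneg ‖complexSnd q‖]

theorem norm_complexSnd_le (q : ℍ[ℝ]) : ‖complexSnd q‖ ≤ ‖q‖ := by
  nlinarith [norm_sq_eq_complex q, norm_nonneg q, norm_nonneg (complexSnd q),
    sq_nonneg ‖complexFst q‖]

theorem norm_coeComplex (z : ℂ) : ‖(z : ℍ[ℝ])‖ = ‖z‖ := by
  have h := norm_sq_eq_complex (z : ℍ[ℝ])
  have h1 : complexFst (z : ℍ[ℝ]) = z := by apply Complex.ext <;> simp [complexFst]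
  have h2 : complexSnd (z : ℍ[ℝ]) = 0 := by apply Complex.ext <;> simp [complexSnd]
  rw [h1, h2, norm_zero, zero_pow two_ne_zero, add_zero] at h
  exact (sq_eq_sq₀ (norm_nonneg _) (norm_nonneg _)).mp h

theorem coeComplex_pow (z : ℂ) (n : ℕ) : ((z ^ n : ℂ) : ℍ[ℝ]) = (z : ℍ[ℝ]) ^ n :=
  map_pow Quaternion.ofComplex z n

theorem star_coeComplex (z : ℂ) : star (z : ℍ[ℝ]) = ((starRingEnd ℂ z : ℂ) : ℍ[ℝ]) := by
  ext <;> simp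

/-- Every quaternion is conjugate to a complex number. -/
theorem exists_mul_eq_coeComplex_mul (q : ℍ[ℝ]) :
    ∃ (z : ℂ) (w : ℍ[ℝ]), w ≠ 0 ∧ w * q = z * w := by
  let v : ℍ[ℝ] := q.im
  let n : ℝ := ‖v‖
  have hn : n * n = q.imI * q.imI + q.imJ * q.imJ + q.imK * q.imK := by
    rw [← Quaternion.normSq_eq_norm_mul_self, Quaternion.normSq_def']
    simp [v]; ring
  -- With `v = Im q` and `n = |v|`, the element `w = v + n i` satisfies `w v = n i w`. It
  -- degenerates only if `v = -n i`, and then `j` conjugates `q` to the required complex number.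
  by_cases h : v + ((⟨0, n⟩ : ℂ) : ℍ[ℝ]) = 0
  · obtain ⟨J, j0, j1, j2, j3⟩ : ∃ J : ℍ[ℝ], J.re = 0 ∧ J.imI = 0 ∧ J.imJ = 1 ∧ J.imK = 0 :=
      ⟨⟨0, 0, 1, 0⟩, rfl, rfl, rfl, rfl⟩
    refine ⟨⟨q.re, n⟩, J, fun h0 => ?_, ?_⟩
    · simp [h0] at j2
    · have h1 := congrArg QuaternionAlgebra.imI h
      have h2 := congrArg QuaternionAlgebra.imJ h
      have h3 := congrArg QuaternionAlgebra.imK h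
      simp [v] at h1 h2 h3
      ext <;> simp [h2, h3, j0, j1, j2, j3]
      linarith
  · refine ⟨⟨q.re, n⟩, _, h, ?_⟩
    ext <;> simp [v] <;> nlinarith

theorem eq_zero_of_hasSum_zero {b : ℕ → ℍ[ℝ]}
    (h : ∀ t : ℝ, |t| < 1 → HasSum (fun n => (t : ℍ[ℝ]) ^ n * b n) 0) : b = 0 := by
  have hs : HasFPowerSeriesAt (0 : ℝ → ℍ[ℝ]) (realSeries b) 0 := by
    rw [hasFPowerSeriesAt_iff]
    filter_upwards [Metric.ball_mem_nhds (0 : ℝ) one_pos] with t ht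
    have h3 : (fun n => t ^ n • (realSeries b).coeff n) = fun n => (t : ℍ[ℝ]) ^ n * b n := by
      funext n
      simp [realSeries, FormalMultilinearSeries.coeff, ← Quaternion.coe_pow,
        Quaternion.coe_mul_eq_smul]
    rw [h3]
    exact h t (by simpa using ht)
  funext n
  have h3 := congrArg (fun p : FormalMultilinearSeries ℝ ℝ ℍ[ℝ] => p.coeff n) hs.eq_zero
  simpa [realSeries, FormalMultilinearSeries.coeff] using h3

variable {F K : PowerSeries ℍ[ℝ]} {a q : ℍ[ℝ]}

/-- Real points already suffice: there `qⁿ w kₙ` is a power of a real variable with coefficient `w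
kₙ`. -/
theorem eq_zero_of_twistedEval_eq_zero (hK : ConvergesOnBall K) {w : ℍ[ℝ]} (hw : w ≠ 0)
    (h : ∀ z : ℂ, ‖z‖ < 1 → twistedEval K z w = 0) : K = 0 := by
  have h1 : (fun n => w * PowerSeries.coeff n K) = 0 := by
    refine eq_zero_of_hasSum_zero fun t ht => ?_
    have h2 := h (t : ℂ) (by simpa using ht)
    rw [Quaternion.coeComplex_coe] at h2
    have h3 := hK.hasSum (q := (t : ℍ[ℝ])) (by simpa using ht) w
    rw [h2] at h3
    simpa only [mul_assoc] using h3
  ext1 n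
  simpa [hw] using congrFun h1 n

/-- Only the powers of `z` vary, and they stand on the far left, where `L` is complex linear; the
result is a locally uniform limit of complex polynomials. -/
theorem differentiableOn_twistedEval (hK : ConvergesOnBall K) (L : ℍ[ℝ] →ₗ[ℝ] ℂ)
    (hL : ∀ (z : ℂ) (q : ℍ[ℝ]), L (z * q) = z * L q) (w v : ℍ[ℝ]) :
    DifferentiableOn ℂ (fun z : ℂ => L (twistedEval K z w * v)) (Metric.ball 0 1) := by
  let L' := LinearMap.toContinuousLinearMap L
  have hL' : ∀ p, L' p = L p := fun _ => rfl
  intro z₀ hz₀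
  obtain ⟨r, hr1, hr2⟩ := exists_between (mem_ball_zero_iff.mp hz₀)
  have hr0 := (norm_nonneg z₀).trans hr1.le
  have hd : DifferentiableOn ℂ
      (fun z : ℂ => ∑' n, z ^ n * L' (w * PowerSeries.coeff n K * v)) (Metric.ball 0 r) := by
    refine Complex.differentiableOn_tsum_of_summable_norm
      (u := fun n => ‖L'‖ * ‖w‖ * ‖v‖ * (r ^ n * ‖PowerSeries.coeff n K‖))
      ((hK r hr0 hr2).mul_left _) (fun n => by fun_prop) Metric.isOpen_ball fun n z hz => ?_
    have hzr : ‖z‖ ≤ r := (mem_ball_zero_iff.mp hz).le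
    calc ‖z ^ n * L' (w * PowerSeries.coeff n K * v)‖
        ≤ r ^ n * (‖L'‖ * (‖w‖ * ‖PowerSeries.coeff n K‖ * ‖v‖)) := by
          rw [norm_mul, norm_pow, ← norm_mul, ← norm_mul]
          gcongr
          exact L'.le_opNorm _
      _ = _ := by ring
  refine ((hd.differentiableAt (Metric.isOpen_ball.mem_nhds (by simpa using hr1))).congr_of_eventuallyEq
    ?_).differentiableWithinAt
  filter_upwards [Metric.isOpen_ball.mem_nhds hz₀] with z hz
  have hz1 : ‖(z : ℍ[ℝ])‖ < 1 := by rw [norm_coeComplex]; exact mem_ball_zero_iff.mp hz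
  have hs := ((hK.hasSum hz1 w).mul_right v).mapL L'
  rw [← hL', ← hs.tsum_eq]
  refine tsum_congr fun n => ?_
  rw [hL', hL', mul_assoc, mul_assoc, ← coeComplex_pow, hL, mul_assoc]

/-- The maximum principle on the unit disc, with a bound near the boundary. -/
theorem norm_le_of_norm_le_near_sphere {h : ℂ → ℂ} (hd : DifferentiableOn ℂ h (Metric.ball 0 1))
    {E : ℝ → ℝ} (hE : ContinuousAt E 1) {ρ : ℝ} (hρ : ρ < 1)
    (hb : ∀ z : ℂ, ρ ≤ ‖z‖ → ‖z‖ < 1 → ‖h z‖ ≤ E ‖z‖) {z : ℂ} (hz : ‖z‖ < 1) : ‖h z‖ ≤ E 1 := by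
  have hlim : Filter.Tendsto E (𝓝[<] 1) (𝓝 (E 1)) := hE.tendsto.mono_left nhdsWithin_le_nhds
  refine ge_of_tendsto hlim ?_
  have h0 : max (max ρ ‖z‖) 0 < 1 := by simp [hρ, hz]
  filter_upwards [Ioo_mem_nhdsLT h0] with r hr
  obtain ⟨hr1, hr2⟩ := hr
  have hr0 : 0 < r := (le_max_right _ _).trans_lt hr1
  have hzr : ‖z‖ < r := ((le_max_right _ _).trans (le_max_left _ _)).trans_lt hr1
  have hρr : ρ < r := ((le_max_left _ _).trans (le_max_left _ _)).trans_lt hr1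
  refine Complex.norm_le_of_forall_mem_frontier_norm_le (U := Metric.ball 0 r) Metric.isBounded_ball
    (DifferentiableOn.diffContOnCl ?_) (fun x hx => ?_) (subset_closure (by simpa using hzr))
  · rw [closure_ball _ hr0.ne']
    exact hd.mono (Metric.closedBall_subset_ball hr2)
  · rw [frontier_ball _ hr0.ne', mem_sphere_zero_iff_norm] at hx
    have := hb x (by rw [hx]; exact hρr.le) (by rwa [hx])
    rwa [hx] at this

end

/-! ### Boundary rigidity -/

section

variable {F K : PowerSeries ℍ[ℝ]} {a q : ℍ[ℝ]}

/-- The Sylvester equation `q w - w a = x`. -/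
theorem exists_mul_sub_mul_eq (h : ‖a‖ < ‖q‖) (x : ℍ[ℝ]) : ∃ w, q * w - w * a = x := by
  let T : ℍ[ℝ] →ₗ[ℝ] ℍ[ℝ] := LinearMap.mulLeft ℝ q - LinearMap.mulRight ℝ a
  have hT : Function.Injective T := by
    rw [← LinearMap.ker_eq_bot, LinearMap.ker_eq_bot']
    intro w hw
    have h1 : q * w = w * a := sub_eq_zero.mp hw
    have h2 : ‖q‖ * ‖w‖ = ‖w‖ * ‖a‖ := by rw [← norm_mul, h1, norm_mul]
    by_contra h0
    have := norm_pos_iff.mpr h0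
    nlinarith
  exact LinearMap.injective_iff_surjective.mp hT x

theorem twistedEval_X_add (hK : ConvergesOnBall K) (h : F = X + (X - C a) * K) (hq : ‖q‖ < 1)
    (w : ℍ[ℝ]) : twistedEval F q w = q * w + twistedEval K q (q * w - w * a) := by
  rw [h, twistedEval_add .X (.mul (.sub .X (.const a)) hK) hq, twistedEval_X,
    twistedEval_X_sub_C_mul hK hq]

/-- Solving `qw - wa = x` turns `K_q(x)` into `F_q(w) - qw`, of norm at most `2|w|`, while `(ρ -
|a|) |w| ≤ |x|`. This keeps `K` bounded up to the boundary. -/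
theorem norm_twistedEval_quotient_le (hK : ConvergesOnBall K) (h : F = X + (X - C a) * K)
    (hF : ∀ p : ℍ[ℝ], ‖p‖ < 1 → ‖twistedEval F p 1‖ ≤ 1) {ρ : ℝ} (haρ : ‖a‖ < ρ) (hρq : ρ ≤ ‖q‖)
    (hq : ‖q‖ < 1) (x : ℍ[ℝ]) : ‖twistedEval K q x‖ ≤ 2 / (ρ - ‖a‖) * ‖x‖ := by
  obtain ⟨w, rfl⟩ := exists_mul_sub_mul_eq (haρ.trans_le hρq) x
  have h1 := norm_twistedEval_le hF hq w
  rw [one_mul] at h1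
  have h2 : ‖twistedEval K q (q * w - w * a)‖ ≤ 2 * ‖w‖ := by
    have e : twistedEval K q (q * w - w * a) = twistedEval F q w - q * w := by
      rw [twistedEval_X_add hK h hq, add_sub_cancel_left]
    rw [e]
    refine (norm_sub_le _ _).trans ?_
    rw [norm_mul]
    nlinarith [norm_nonneg w]
  have h3 : (ρ - ‖a‖) * ‖w‖ ≤ ‖q * w - w * a‖ := by
    have := norm_sub_norm_le (q * w) (w * a)
    rw [norm_mul, norm_mul] at this
    nlinarith [norm_nonneg w]
  have h4 : 0 < ρ - ‖a‖ := sub_pos.mpr haρ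
  rw [div_mul_eq_mul_div, le_div_iff₀ h4]
  nlinarith

theorem re_mul_comm (p q : ℍ[ℝ]) : (p * q).re = (q * p).re := by
  simp; ring

/-- In `κ x̄` some factors depending on `z` stand on the right, where they are not complex linear in
the chosen coordinates. Under the real part they may be cycled to the left. -/
theorem re_mul_sub_mul (u z k s a : ℍ[ℝ]) (h : u * z = z * u) :
    (u * (k * s - z * (k * (a * s)))).re = (k * ((s - a * (s * z)) * u)).re := by
  have e1 : k * ((s - a * (s * z)) * u) = (k * (s - a * (s * z))) * u := by noncomm_ring
  have e2 : (u * (z * (k * (a * s)))).re = (u * (k * (a * (s * z)))).re := by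
    rw [← mul_assoc u z, h, mul_assoc z, re_mul_comm z]
    congr 1
    noncomm_ring
  rw [e1, re_mul_comm _ u, mul_sub, mul_sub, mul_sub, Quaternion.re_sub, Quaternion.re_sub, e2]

theorem norm_add_sq (p q : ℍ[ℝ]) : ‖p + q‖ ^ 2 = ‖p‖ ^ 2 + 2 * (q * star p).re + ‖q‖ ^ 2 := by
  simp only [sq, ← Quaternion.normSq_eq_norm_mul_self, Quaternion.normSq_def']
  simp
  ring

/-- The reversed characteristic polynomial `1 - 2 Re(a) z + |a|² z²` of `a`. -/
def reverseCharpoly (a : ℍ[ℝ]) (z : ℂ) : ℂ :=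
  1 - z * (2 * a.re : ℝ) + z * z * (Quaternion.normSq a : ℝ)

theorem coe_reverseCharpoly (a : ℍ[ℝ]) (z : ℂ) : (reverseCharpoly a z : ℍ[ℝ]) =
    1 - z * ((2 * a.re : ℝ) : ℍ[ℝ]) + z * z * ((Quaternion.normSq a : ℝ) : ℍ[ℝ]) := by
  have hsub : ∀ u v : ℂ, ((u - v : ℂ) : ℍ[ℝ]) = u - v := fun u v => map_sub Quaternion.ofComplex u v
  rw [reverseCharpoly, Quaternion.coeComplex_add, hsub, Quaternion.coeComplex_one,
    Quaternion.coeComplex_mul, Quaternion.coeComplex_mul, Quaternion.coeComplex_mul,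
    Quaternion.coeComplex_coe, Quaternion.coeComplex_coe]

theorem reverseCharpoly_ne_zero (ha : ‖a‖ < 1) {z : ℂ} (hz : ‖z‖ < 1) : reverseCharpoly a z ≠ 0 := by
  intro h
  have hz' : ‖(z : ℍ[ℝ])‖ ≤ 1 := by rw [norm_coeComplex]; exact hz.le
  have h1 := coe_reverseCharpoly a z
  rw [h, Quaternion.coeComplex_zero, ← one_sub_mul_sub_mul_star] at h1
  exact one_sub_mul_ne_zero ha hz' (eq_zero_of_eq_mul_mul (by rwa [norm_star]) hz' h1.symm)

theorem differentiable_reverseCharpoly (a : ℍ[ℝ]) : Differentiable ℂ (reverseCharpoly a) := by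
  unfold reverseCharpoly; fun_prop

theorem conj_reverseCharpoly (a : ℍ[ℝ]) (z : ℂ) :
    starRingEnd ℂ (reverseCharpoly a (starRingEnd ℂ z)) = reverseCharpoly a z := by
  simp [reverseCharpoly, Complex.conj_ofNat]

/-- The solution `x` of the Stein equation `x - z̄ x a = w`. -/
def steinSolution (a w : ℍ[ℝ]) (z : ℂ) : ℍ[ℝ] :=
  ((reverseCharpoly a (starRingEnd ℂ z))⁻¹ : ℂ) *
    (w - ((starRingEnd ℂ z : ℂ) : ℍ[ℝ]) * w * star a)

theorem steinSolution_sub (ha : ‖a‖ < 1) (w : ℍ[ℝ]) {z : ℂ} (hz : ‖z‖ < 1) :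
    steinSolution a w z - ((starRingEnd ℂ z : ℂ) : ℍ[ℝ]) * steinSolution a w z * a = w := by
  set y : ℂ := starRingEnd ℂ z with hy
  have hy1 : ‖y‖ < 1 := by rw [hy, RCLike.norm_conj]; exact hz
  have hD := reverseCharpoly_ne_zero ha hy1
  have hc : (y : ℍ[ℝ]) * ((reverseCharpoly a y)⁻¹ : ℂ) = ((reverseCharpoly a y)⁻¹ : ℂ) * y := by
    rw [← Quaternion.coeComplex_mul, ← Quaternion.coeComplex_mul, mul_comm]
  have h1 : (w - (y : ℍ[ℝ]) * w * star a) - y * (w - (y : ℍ[ℝ]) * w * star a) * a =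
      reverseCharpoly a y * w := by
    rw [coe_reverseCharpoly, add_mul, sub_mul, one_mul, mul_assoc (y : ℍ[ℝ]) _ w,
      mul_assoc ((y : ℍ[ℝ]) * y) _ w, Quaternion.coe_commutes (2 * a.re) w,
      Quaternion.coe_commutes (Quaternion.normSq a) w,
      ← Quaternion.star_mul_self, ← Quaternion.self_add_star']
    noncomm_ring
  rw [steinSolution, ← hy, ← mul_assoc (y : ℍ[ℝ]), hc, mul_assoc _ (y : ℍ[ℝ]),
    mul_assoc _ ((y : ℍ[ℝ]) * _) a, ← mul_sub, h1, ← mul_assoc,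
    ← Quaternion.coeComplex_mul, inv_mul_cancel₀ hD, Quaternion.coeComplex_one, one_mul]

theorem norm_steinSolution_le (ha : ‖a‖ < 1) (w : ℍ[ℝ]) {z : ℂ} (hz : ‖z‖ < 1) :
    ‖steinSolution a w z‖ ≤ ‖w‖ / (1 - ‖a‖) := by
  have h := steinSolution_sub ha w hz
  set x := steinSolution a w z
  have h1 : ‖x‖ ≤ ‖w‖ + ‖z‖ * ‖x‖ * ‖a‖ := by
    have e : x = w + ((starRingEnd ℂ z : ℂ) : ℍ[ℝ]) * x * a := by rw [← h]; abel
    calc ‖x‖ = ‖w + ((starRingEnd ℂ z : ℂ) : ℍ[ℝ]) * x * a‖ := by rw [← e]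
      _ ≤ _ := (norm_add_le _ _).trans (by
        rw [norm_mul, norm_mul, norm_coeComplex, RCLike.norm_conj])
  rw [le_div_iff₀ (sub_pos.mpr ha)]
  nlinarith [mul_nonneg (norm_nonneg x) (norm_nonneg a)]

/-- The holomorphic function with real part `Re (κ x̄)`, where `κ = ∑ zⁿ w kₙ` and `x` solves the
Stein equation `x - z̄ x a = w`. -/
def steinPairing (K : PowerSeries ℍ[ℝ]) (a w : ℍ[ℝ]) (z : ℂ) : ℂ :=
  (reverseCharpoly a z)⁻¹ * (complexFst (twistedEval K z w * star w) -
    z * complexFst (twistedEval K z w * (a * star w)))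

theorem re_steinPairing (K : PowerSeries ℍ[ℝ]) (a w : ℍ[ℝ]) (z : ℂ) :
    (steinPairing K a w z).re = (twistedEval K z w * star (steinSolution a w z)).re := by
  have e : steinPairing K a w z = complexFst (((reverseCharpoly a z)⁻¹ : ℂ) *
      (twistedEval K z w * star w - z * (twistedEval K z w * (a * star w)))) := by
    rw [complexFst_coe_mul, map_sub, complexFst_coe_mul, steinPairing]
  rw [e, re_complexFst, steinSolution, star_mul, star_coeComplex, map_inv₀, conj_reverseCharpoly,
    star_sub, star_mul, star_mul, star_star, star_coeComplex, Complex.conj_conj]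
  refine re_mul_sub_mul _ _ _ _ _ ?_
  rw [← Quaternion.coeComplex_mul, ← Quaternion.coeComplex_mul, mul_comm]

theorem differentiableOn_steinPairing (hK : ConvergesOnBall K) (ha : ‖a‖ < 1) (w : ℍ[ℝ]) :
    DifferentiableOn ℂ (steinPairing K a w) (Metric.ball 0 1) := by
  have h := fun v => differentiableOn_twistedEval hK complexFst complexFst_coe_mul w v
  refine DifferentiableOn.mul ?_ ((h _).sub (differentiableOn_id.mul (h _)))
  exact (differentiable_reverseCharpoly a).differentiableOn.inv fun z hz =>
    reverseCharpoly_ne_zero ha (mem_ball_zero_iff.mp hz)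

theorem norm_sq_add_steinPairing_le (hK : ConvergesOnBall K) (h : F = X + (X - C a) * K)
    (hF : ∀ p : ℍ[ℝ], ‖p‖ < 1 → ‖twistedEval F p 1‖ ≤ 1) {ρ : ℝ} (haρ : ‖a‖ < ρ) (hρ : ρ < 1)
    (w : ℍ[ℝ]) : ∃ c : ℝ, ∀ z : ℂ, ρ ≤ ‖z‖ → ‖z‖ < 1 →
      ‖twistedEval K z w‖ ^ 2 + 2 * (steinPairing K a w z).re ≤ c * (1 - ‖z‖ ^ 2) := by
  have ha := haρ.trans hρ
  have hb : 0 < 1 - ‖a‖ := sub_pos.mpr ha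
  have hd : 0 < ρ - ‖a‖ := sub_pos.mpr haρ
  set M : ℝ := ‖w‖ / (1 - ‖a‖) + 2 / (ρ - ‖a‖) * (‖w‖ / (1 - ‖a‖)) with hM
  -- `M` bounds `|x|` and `|x| + |K_z(x)|`. With `ε = 1 - |z|² ≤ 1`, `(|x| + εM)² - |x|² ≤ 2εM² +
  -- ε²M² ≤ 3M²ε`.
  refine ⟨3 * M ^ 2, fun z hz1 hz2 => ?_⟩
  have hz : ‖(z : ℍ[ℝ])‖ = ‖z‖ := norm_coeComplex z
  have hzq : ‖(z : ℍ[ℝ])‖ < 1 := by rwa [hz]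
  have hx := steinSolution_sub ha w hz2
  have hxn := norm_steinSolution_le ha w hz2
  have hP := re_steinPairing K a w z
  set x := steinSolution a w z
  set κ := twistedEval K z w
  set ε : ℝ := 1 - ‖z‖ ^ 2 with hε
  have hε0 : 0 ≤ ε := by rw [hε]; nlinarith [norm_nonneg z]
  have hε1 : ε ≤ 1 := by rw [hε]; nlinarith [norm_nonneg z]
  have hKx : ‖twistedEval K z x‖ ≤ 2 / (ρ - ‖a‖) * (‖w‖ / (1 - ‖a‖)) :=
    (norm_twistedEval_quotient_le hK h hF haρ (by rwa [hz]) hzq x).trans (by gcongr)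
  have hxM : ‖x‖ ≤ M := hxn.trans (le_add_of_nonneg_right (by positivity))
  have hM0 : 0 ≤ M := (norm_nonneg x).trans hxM
  have hzz : (z : ℍ[ℝ]) * ((starRingEnd ℂ z : ℂ) : ℍ[ℝ]) = ((1 - ε : ℝ) : ℍ[ℝ]) := by
    rw [← Quaternion.coeComplex_mul, Complex.mul_conj, Quaternion.coeComplex_coe, hε,
      Complex.normSq_eq_norm_sq, sub_sub_cancel]
  -- Evaluating at `z̄x` makes the argument of `K_z` equal to `z z̄ x - z̄ x a = w - εx`, by the
  -- Stein equation.
  have h1 := norm_twistedEval_le hF hzq (((starRingEnd ℂ z : ℂ) : ℍ[ℝ]) * x)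
  have e1 : (z : ℍ[ℝ]) * (((starRingEnd ℂ z : ℂ) : ℍ[ℝ]) * x) = x - (ε : ℍ[ℝ]) * x := by
    rw [← mul_assoc, hzz, Quaternion.coe_sub, Quaternion.coe_one, sub_mul, one_mul]
  have e2 : (z : ℍ[ℝ]) * (((starRingEnd ℂ z : ℂ) : ℍ[ℝ]) * x) -
      ((starRingEnd ℂ z : ℂ) : ℍ[ℝ]) * x * a = w - (ε : ℍ[ℝ]) * x := by
    rw [e1, ← hx]; abel
  rw [twistedEval_X_add hK h hzq, e2, e1, twistedEval_sub_right hK hzq,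
    twistedEval_commute_mul (Quaternion.coe_commutes ε _), one_mul, norm_mul, norm_coeComplex,
    RCLike.norm_conj] at h1
  have h2 : ‖x + κ‖ ≤ ‖x‖ + ε * M := by
    have e3 : x + κ = (x - (ε : ℍ[ℝ]) * x + (κ - (ε : ℍ[ℝ]) * twistedEval K z x)) +
        (ε : ℍ[ℝ]) * (x + twistedEval K z x) := by noncomm_ring
    rw [e3]
    refine (norm_add_le _ _).trans (add_le_add (h1.trans ?_) ?_)
    · exact mul_le_of_le_one_left (norm_nonneg x) hz2.le
    · rw [norm_mul, Quaternion.norm_coe, Real.norm_of_nonneg hε0]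
      gcongr
      exact (norm_add_le _ _).trans (add_le_add hxn hKx)
  have h3 : ‖x + κ‖ ^ 2 ≤ (‖x‖ + ε * M) ^ 2 := by gcongr
  rw [norm_add_sq, ← hP] at h3
  have h4 : ε * M * ‖x‖ ≤ ε * M * M := by gcongr
  have h5 : ε * (ε * M ^ 2) ≤ 1 * (ε * M ^ 2) := by gcongr
  nlinarith

/-- **Boundary rigidity**: if `q + (q - a) * k(q)` is bounded by `1` on the ball and `k` has a zero
there, then `k = 0`. -/
theorem eq_zero_of_twistedEval_eq_zero_of_bounded (hK : ConvergesOnBall K)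
    (h : F = X + (X - C a) * K) (hF : ∀ p : ℍ[ℝ], ‖p‖ < 1 → ‖twistedEval F p 1‖ ≤ 1)
    (ha : ‖a‖ < 1) (hq : ‖q‖ < 1) (h0 : twistedEval K q 1 = 0) : K = 0 := by
  obtain ⟨ρ, haρ, hρ⟩ := exists_between ha
  obtain ⟨z₀, w, hw, hqz⟩ := exists_mul_eq_coeComplex_mul q
  obtain ⟨c, hc⟩ := norm_sq_add_steinPairing_le hK h hF haρ hρ w
  have hq' : q = w⁻¹ * z₀ * w := by rw [mul_assoc, ← hqz, inv_mul_cancel_left₀ hw]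
  have hz₀ : ‖z₀‖ < 1 := by
    rw [← norm_coeComplex, ← norm_conj_mul _ hw, ← hq']; exact hq
  have hκ₀ : twistedEval K z₀ w = 0 := by
    rw [twistedEval_eq_mul K _ hw, ← hq', h0, mul_zero]
  have hP₀ : steinPairing K a w z₀ = 0 := by simp [steinPairing, hκ₀]
  -- The exponential turns bounds on `Re P` into bounds on a modulus, to which the maximum principle
  -- applies.
  have hPd := (differentiableOn_steinPairing hK ha w).cexp
  have hPle : ∀ z : ℂ, ‖z‖ < 1 → ‖Complex.exp (steinPairing K a w z)‖ ≤ 1 := by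
    intro z hz
    refine (norm_le_of_norm_le_near_sphere hPd (E := fun r => Real.exp (c * (1 - r ^ 2) / 2))
      (by fun_prop) hρ (fun z hz1 hz2 => ?_) hz).trans (by simp)
    rw [Complex.norm_exp]
    gcongr
    linarith [hc z hz1 hz2, sq_nonneg ‖twistedEval K z w‖]
  have hP1 : ∀ z : ℂ, ‖z‖ < 1 → (steinPairing K a w z).re = 0 := by
    intro z hz
    have hmax : IsMaxOn (norm ∘ fun z => Complex.exp (steinPairing K a w z)) (Metric.ball 0 1) z₀ := by
      intro y hy
      simpa [hP₀] using hPle y (mem_ball_zero_iff.mp hy)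
    have h1 := Complex.norm_eqOn_of_isPreconnected_of_isMaxOn (convex_ball _ _).isPreconnected
      Metric.isOpen_ball hPd (mem_ball_zero_iff.mpr hz₀) hmax (mem_ball_zero_iff.mpr hz)
    simpa [hP₀, Complex.norm_exp] using h1
  have hcoord : ∀ L : ℍ[ℝ] →ₗ[ℝ] ℂ, (∀ (z : ℂ) (q : ℍ[ℝ]), L (z * q) = z * L q) →
      (∀ q, ‖L q‖ ≤ ‖q‖) → ∀ z : ℂ, ‖z‖ < 1 → L (twistedEval K z w) = 0 := by
    intro L hL hLn z hz
    -- The square is used because the available estimate is on `|κ|²`.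
    have hd := (differentiableOn_twistedEval hK L hL w 1).pow 2
    have := norm_le_of_norm_le_near_sphere hd (E := fun r => c * (1 - r ^ 2)) (by fun_prop) hρ
      (fun y hy1 hy2 => by
        have h1 := hc y hy1 hy2
        rw [hP1 y hy2, mul_zero, add_zero] at h1
        refine le_trans ?_ h1
        rw [Pi.pow_apply, norm_pow, mul_one]
        gcongr
        exact hLn _) hz
    simpa using this
  refine eq_zero_of_twistedEval_eq_zero hK hw fun z hz => ?_
  rw [← norm_eq_zero, ← sq_eq_zero_iff, norm_sq_eq_complex,
    hcoord _ complexFst_coe_mul norm_complexFst_le z hz,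
    hcoord _ complexSnd_coe_mul norm_complexSnd_le z hz]
  simp

end

/-! ### Power series expansion of slice regular functions -/

section

variable {f : ℍ[ℝ] → ℍ[ℝ]} {F K : PowerSeries ℍ[ℝ]} {a q w : ℍ[ℝ]}

theorem exists_hasSum_pow_mul {h : ℂ → ℂ} (hd : DifferentiableOn ℂ h (Metric.ball 0 1)) :
    ∃ c : ℕ → ℂ, ∀ z : ℂ, ‖z‖ < 1 → HasSum (fun n => z ^ n * c n) (h z) := by
  refine ⟨fun n => (n.factorial : ℂ)⁻¹ * iteratedDeriv n h 0, fun z hz => ?_⟩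
  refine (Complex.hasSum_taylorSeries_on_ball hd (mem_ball_zero_iff.mpr hz)).congr_fun ?_
  intro n
  simp only [sub_zero, smul_eq_mul]
  ring

theorem coeComplex_I_mul_self : ((Complex.I : ℂ) : ℍ[ℝ]) * (Complex.I : ℂ) = -1 := by
  rw [← Quaternion.coeComplex_mul, Complex.I_mul_I]
  exact map_neg Quaternion.ofComplex 1

theorem conj_I_mem_imaginaryUnits (hw : w ≠ 0) :
    w⁻¹ * (Complex.I : ℂ) * w ∈ imaginaryUnits := by
  change (w⁻¹ * (Complex.I : ℂ) * w) ^ 2 = -1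
  have h : (w⁻¹ * (Complex.I : ℂ) * w) ^ 2 = w⁻¹ * (((Complex.I : ℂ) : ℍ[ℝ]) * (Complex.I : ℂ)) * w := by
    rw [sq]; simp only [mul_assoc, mul_inv_cancel_left₀ hw]
  rw [h, coeComplex_I_mul_self]
  simp [hw]

theorem conj_coeComplex (hw : w ≠ 0) (z : ℂ) :
    (z.re : ℍ[ℝ]) + w⁻¹ * (Complex.I : ℂ) * w * (z.im : ℍ[ℝ]) = w⁻¹ * z * w := by
  have h : (z : ℍ[ℝ]) = (z.re : ℍ[ℝ]) + (Complex.I : ℂ) * (z.im : ℍ[ℝ]) := by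
    ext <;> simp
  rw [h, mul_add, add_mul, ← Quaternion.coe_commutes z.re w⁻¹,
    mul_assoc (z.re : ℍ[ℝ]) w⁻¹ w, inv_mul_cancel₀ hw, mul_one]
  simp only [mul_assoc, Quaternion.coe_commutes z.im w]

/-- A slice regular function is holomorphic on each slice, in complex coordinates. -/
theorem SliceRegularOn.differentiableOn (hf : SliceRegularOn f unitBall) (hw : w ≠ 0)
    (L : ℍ[ℝ] →ₗ[ℝ] ℂ) (hL : ∀ (z : ℂ) (q : ℍ[ℝ]), L (z * q) = z * L q) :
    DifferentiableOn ℂ (fun z : ℂ => L (w * f (w⁻¹ * z * w))) (Metric.ball 0 1) := by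
  intro z hz
  refine DifferentiableAt.differentiableWithinAt ?_
  set I : ℍ[ℝ] := w⁻¹ * (Complex.I : ℂ) * w with hI
  have hmem : (z.re : ℍ[ℝ]) + I * (z.im : ℍ[ℝ]) ∈ unitBall := by
    rw [hI, conj_coeComplex hw, mem_unitBall, norm_conj_mul _ hw, norm_coeComplex]
    exact mem_ball_zero_iff.mp hz
  obtain ⟨hd, hcr⟩ := hf I (conj_I_mem_imaginaryUnits hw) z.re z.im hmem
  have hcr := (smul_eq_zero.mp hcr).resolve_left (by norm_num)
  set g : ℝ × ℝ → ℍ[ℝ] := fun p => f ((p.1 : ℍ[ℝ]) + I * (p.2 : ℍ[ℝ])) with hg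
  have hX : partialX f I z.re z.im = fderiv ℝ g (z.re, z.im) (1, 0) :=
    (hd.hasFDerivAt.comp_hasDerivAt (f := fun s : ℝ => (s, z.im)) z.re
      ((hasDerivAt_id z.re).prodMk (hasDerivAt_const z.re z.im))).deriv
  have hY : partialY f I z.re z.im = fderiv ℝ g (z.re, z.im) (0, 1) :=
    (hd.hasFDerivAt.comp_hasDerivAt (f := fun s : ℝ => (z.re, s)) z.im
      ((hasDerivAt_const z.im z.re).prodMk (hasDerivAt_id z.im))).deriv
  rw [hX, hY] at hcr
  let T : ℍ[ℝ] →L[ℝ] ℂ := (LinearMap.toContinuousLinearMap L).comp (ContinuousLinearMap.mul ℝ ℍ[ℝ] w)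
  have hT : ∀ p, T p = L (w * p) := fun _ => rfl
  have hF : HasFDerivAt (fun z : ℂ => T (g (Complex.equivRealProdCLM z)))
      (T.comp ((fderiv ℝ g (z.re, z.im)).comp (Complex.equivRealProdCLM : ℂ →L[ℝ] ℝ × ℝ))) z := by
    have hg' : HasFDerivAt g (fderiv ℝ g (z.re, z.im)) (Complex.equivRealProdCLM z) := hd.hasFDerivAt
    have h1 : HasFDerivAt (g ∘ Complex.equivRealProdCLM) _ z :=
      hg'.comp z Complex.equivRealProdCLM.hasFDerivAt
    exact T.hasFDerivAt.comp z h1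
  have heq : (fun z : ℂ => L (w * f (w⁻¹ * z * w))) = fun z : ℂ => T (g (Complex.equivRealProdCLM z)) := by
    funext y
    rw [hT, hg, ← conj_coeComplex hw]
    rfl
  rw [heq, differentiableAt_complex_iff_differentiableAt_real]
  refine ⟨hF.differentiableAt, ?_⟩
  rw [hF.fderiv]
  change T (fderiv ℝ g (z.re, z.im) (Complex.I.re, Complex.I.im)) =
    Complex.I * T (fderiv ℝ g (z.re, z.im) ((1 : ℂ).re, (1 : ℂ).im))
  rw [Complex.I_re, Complex.I_im, Complex.one_re, Complex.one_im, hT, hT, ← hL]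
  congr 1
  -- Since `w I = i w`, left multiplication by `w` carries the slice equation `∂ₓ + I ∂ᵧ = 0` to the
  -- Cauchy–Riemann equation.
  rw [eq_neg_of_add_eq_zero_left hcr, hI, mul_neg, mul_neg, ← mul_assoc w, ← mul_assoc w,
    ← mul_assoc w, mul_inv_cancel₀ hw, one_mul, ← mul_assoc, ← mul_assoc, coeComplex_I_mul_self]
  noncomm_ring

/-- The Taylor series of the two coordinates reassemble to `w f(w⁻¹zw) = ∑ zⁿ (cₙ + dₙ j)`; the
factor `w⁻¹` then turns `zⁿ` into `(w⁻¹zw)ⁿ`. -/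
theorem SliceRegularOn.exists_hasSum (hf : SliceRegularOn f unitBall) (hw : w ≠ 0) :
    ∃ b : ℕ → ℍ[ℝ], ∀ z : ℂ, ‖z‖ < 1 →
      HasSum (fun n => (w⁻¹ * z * w) ^ n * b n) (f (w⁻¹ * z * w)) := by
  obtain ⟨c, hc⟩ := exists_hasSum_pow_mul (hf.differentiableOn hw complexFst complexFst_coe_mul)
  obtain ⟨d, hd⟩ := exists_hasSum_pow_mul (hf.differentiableOn hw complexSnd complexSnd_coe_mul)
  obtain ⟨J, j0, j1, j2, j3⟩ : ∃ J : ℍ[ℝ], J.re = 0 ∧ J.imI = 0 ∧ J.imJ = 1 ∧ J.imK = 0 :=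
    ⟨⟨0, 0, 1, 0⟩, rfl, rfl, rfl, rfl⟩
  have hsplit : ∀ q : ℍ[ℝ], q = (complexFst q : ℍ[ℝ]) + (complexSnd q : ℍ[ℝ]) * J := by
    intro q
    ext <;> simp [complexFst, complexSnd, j0, j1, j2, j3]
  have hcont : Continuous coeComplex :=
    (LinearMap.toContinuousLinearMap Quaternion.ofComplex.toLinearMap).continuous
  refine ⟨fun n => w⁻¹ * ((c n : ℍ[ℝ]) + (d n : ℍ[ℝ]) * J), fun z hz => ?_⟩
  have h1 := (hc z hz).map Quaternion.ofComplex hcont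
  have h2 := ((hd z hz).map Quaternion.ofComplex hcont).mul_right J
  have h3 := (h1.add h2).mul_left w⁻¹
  simp only [Quaternion.coe_ofComplex, Function.comp_apply, ← hsplit,
    inv_mul_cancel_left₀ hw] at h3
  refine h3.congr_fun fun n => ?_
  rw [conj_pow_eq _ hw, Quaternion.coeComplex_mul, Quaternion.coeComplex_mul, coeComplex_pow]
  simp only [mul_assoc, mul_inv_cancel_left₀ hw, mul_add]

/-- Every slice regular function on the unit ball is the sum of a power series. -/
theorem SliceRegularOn.exists_hasPowerSeries (hf : SliceRegularOn f unitBall) :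
    ∃ F, HasPowerSeries f F := by
  obtain ⟨b, hb⟩ := hf.exists_hasSum (one_ne_zero : (1 : ℍ[ℝ]) ≠ 0)
  refine ⟨PowerSeries.mk b, fun q hq => ?_⟩
  obtain ⟨z, w, hw, hqz⟩ := exists_mul_eq_coeComplex_mul q
  have hq' : q = w⁻¹ * z * w := by rw [mul_assoc, ← hqz, inv_mul_cancel_left₀ hw]
  obtain ⟨c, hc⟩ := hf.exists_hasSum hw
  have hreal : ∀ {v : ℍ[ℝ]}, v ≠ 0 → ∀ t : ℝ, v⁻¹ * ((t : ℂ) : ℍ[ℝ]) * v = (t : ℍ[ℝ]) := by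
    intro v hv t
    rw [Quaternion.coeComplex_coe, mul_assoc, Quaternion.coe_commutes, inv_mul_cancel_left₀ hv]
  -- All slices share the real diameter, so the coefficients do not depend on the slice.
  have hbc : c - b = 0 := by
    refine eq_zero_of_hasSum_zero fun t ht => ?_
    have h1 := hb (t : ℂ) (by simpa using ht)
    have h2 := hc (t : ℂ) (by simpa using ht)
    rw [hreal one_ne_zero] at h1
    rw [hreal hw] at h2
    simpa [mul_sub] using h2.sub h1
  rw [sub_eq_zero] at hbc
  subst hbc
  simp only [PowerSeries.coeff_mk]
  rw [mem_unitBall, hq', norm_conj_mul _ hw, norm_coeComplex] at hq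
  rw [hq']
  exact hc z hq

theorem unitOf_mul_norm (q : ℍ[ℝ]) : unitOf q * (‖q.im‖ : ℍ[ℝ]) = q.im := by
  rw [Quaternion.mul_coe_eq_smul, unitOf]
  split_ifs with h
  · simp [h]
  · rw [smul_smul, mul_inv_cancel₀ (norm_ne_zero_iff.mpr h), one_smul]

theorem re_add_unitOf_mul_norm (q : ℍ[ℝ]) : (q.re : ℍ[ℝ]) + unitOf q * (‖q.im‖ : ℍ[ℝ]) = q := by
  rw [unitOf_mul_norm, Quaternion.re_add_im]

theorem unitOf_mul_self (q : ℍ[ℝ]) : unitOf q * unitOf q = -1 := by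
  rw [unitOf]
  split_ifs with h
  · exact coeComplex_I_mul_self
  · have h1 : q.im * q.im = -((‖q.im‖ * ‖q.im‖ : ℝ) : ℍ[ℝ]) := by
      rw [← Quaternion.normSq_eq_norm_mul_self, ← Quaternion.self_mul_star, Quaternion.star_im,
        mul_neg, neg_neg]
    have h2 := norm_ne_zero_iff.mpr h
    rw [smul_mul_smul_comm, h1, smul_neg, ← Quaternion.coe_mul_eq_smul, ← Quaternion.coe_mul,
      mul_mul_mul_comm, inv_mul_cancel₀ h2, one_mul, Quaternion.coe_one]

theorem commute_unitOf (q : ℍ[ℝ]) : Commute (unitOf q) q := by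
  conv_rhs => rw [← re_add_unitOf_mul_norm q]
  exact (Quaternion.coe_commute q.re (unitOf q)).symm.add_right
    ((Commute.refl _).mul_right (Quaternion.coe_commute _ _).symm)

end

/-! ### Cullen and spherical derivatives -/

section

variable {f : ℍ[ℝ] → ℍ[ℝ]} {F K : PowerSeries ℍ[ℝ]} {a q : ℍ[ℝ]}

/-- At points commuting with `a` the regular product with `q - a` is the pointwise one. This covers
the slice through `a`, in particular `ā`. -/
theorem HasPowerSeries.eq_add_sub_mul (hf : HasPowerSeries f F) (hK : ConvergesOnBall K)
    (h : F = X + (X - C a) * K) (hq : ‖q‖ < 1) (hc : Commute a q) :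
    f q = q + (q - a) * twistedEval K q 1 := by
  have e := twistedEval_commute_mul (A := K) ((Commute.refl q).sub_left hc) 1
  rw [mul_one] at e
  rw [hf.eq_twistedEval hq, twistedEval_X_add hK h hq, mul_one, one_mul, e]

theorem hasDerivAt_add_smul {φ : ℝ → ℍ[ℝ]} (hφ : ContinuousAt φ 0) (c : ℍ[ℝ]) :
    HasDerivAt (fun t : ℝ => c + t • φ t) (φ 0) 0 := by
  rw [hasDerivAt_iff_tendsto_slope]
  refine (hφ.tendsto.mono_left nhdsWithin_le_nhds).congr' ?_
  filter_upwards [self_mem_nhdsWithin] with t ht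
  have ht0 : t ≠ 0 := ht
  simp [slope, smul_smul, inv_mul_cancel₀ ht0]

/-- Directional derivatives of `f` within the slice through `a`. -/
theorem HasPowerSeries.hasDerivAt_line (hf : HasPowerSeries f F) (hK : ConvergesOnBall K)
    (h : F = X + (X - C a) * K) (ha : ‖a‖ < 1) {e : ℍ[ℝ]} (hc : Commute a e) :
    HasDerivAt (fun t : ℝ => f (a + (t : ℍ[ℝ]) * e)) (e * (1 + twistedEval K a 1)) 0 := by
  have hline : Continuous fun t : ℝ => a + (t : ℍ[ℝ]) * e :=
    continuous_const.add (Quaternion.continuous_coe.mul continuous_const)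
  have h0 : a + ((0 : ℝ) : ℍ[ℝ]) * e = a := by simp
  have hφ : ContinuousAt (fun t : ℝ => e * (1 + twistedEval K (a + (t : ℍ[ℝ]) * e) 1)) 0 := by
    refine continuousAt_const.mul (continuousAt_const.add ?_)
    exact ContinuousAt.comp (f := fun t : ℝ => a + (t : ℍ[ℝ]) * e)
      (g := fun p => twistedEval K p 1)
      (by rw [h0]; exact continuousAt_twistedEval hK ha 1) hline.continuousAt
  have hd := hasDerivAt_add_smul hφ a
  rw [h0] at hd
  refine hd.congr_of_eventuallyEq ?_
  have hball : ∀ᶠ t : ℝ in 𝓝 0, ‖a + (t : ℍ[ℝ]) * e‖ < 1 :=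
    (hline.norm.tendsto 0).eventually_lt_const (by simpa [h0] using ha)
  filter_upwards [hball] with t ht
  have hct : Commute a (a + (t : ℍ[ℝ]) * e) :=
    (Commute.refl a).add_right ((Quaternion.coe_commute t a).symm.mul_right hc)
  rw [hf.eq_add_sub_mul hK h ht hct, add_sub_cancel_left, ← Quaternion.coe_mul_eq_smul]
  noncomm_ring

/-- The directions `1` and `I` in the slice of `a` yield the derivatives `1 + K(a)` and `I (1 +
K(a))`, and `I² = -1`. -/
theorem HasPowerSeries.cullenDeriv_eq_one_add (hf : HasPowerSeries f F) (hK : ConvergesOnBall K)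
    (h : F = X + (X - C a) * K) (ha : ‖a‖ < 1) : cullenDeriv f a = 1 + twistedEval K a 1 := by
  have hX : partialX f (unitOf a) a.re ‖a.im‖ = 1 + twistedEval K a 1 := by
    have h1 := hf.hasDerivAt_line hK h ha (Commute.one_right a)
    rw [← sub_self a.re] at h1
    have h2 := h1.comp_sub_const a.re a.re
    rw [partialX, ← one_mul (1 + twistedEval K a 1), ← h2.deriv]
    congr 1
    funext s
    have e : (s : ℍ[ℝ]) + unitOf a * (‖a.im‖ : ℍ[ℝ]) =
        (a.re : ℍ[ℝ]) + unitOf a * (‖a.im‖ : ℍ[ℝ]) + ((s - a.re : ℝ) : ℍ[ℝ]) * 1 := by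
      rw [Quaternion.coe_sub]; noncomm_ring
    rw [e, re_add_unitOf_mul_norm]
  have hY : partialY f (unitOf a) a.re ‖a.im‖ = unitOf a * (1 + twistedEval K a 1) := by
    have h1 := hf.hasDerivAt_line hK h ha (commute_unitOf a).symm
    rw [← sub_self ‖a.im‖] at h1
    have h2 := h1.comp_sub_const ‖a.im‖ ‖a.im‖
    rw [partialY, ← h2.deriv]
    congr 1
    funext s
    have e : (a.re : ℍ[ℝ]) + unitOf a * (s : ℍ[ℝ]) =
        (a.re : ℍ[ℝ]) + unitOf a * (‖a.im‖ : ℍ[ℝ]) + ((s - ‖a.im‖ : ℝ) : ℍ[ℝ]) * unitOf a := by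
      rw [Quaternion.coe_commutes, Quaternion.coe_sub]; noncomm_ring
    rw [e, re_add_unitOf_mul_norm]
  rw [cullenDeriv, hX, hY, ← mul_assoc, unitOf_mul_self, neg_one_mul, sub_neg_eq_add, ← two_smul ℝ,
    smul_smul]
  norm_num

theorem cullenDeriv_eq_one_of_hasFDerivAt
    (h : HasFDerivAt f (ContinuousLinearMap.id ℝ ℍ[ℝ]) a) : cullenDeriv f a = 1 := by
  have hcoe : ∀ t : ℝ, HasDerivAt (fun s : ℝ => (s : ℍ[ℝ])) 1 t := by
    intro t
    have := (hasDerivAt_id t).smul_const (1 : ℍ[ℝ])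
    simpa [Quaternion.smul_coe, ← Quaternion.coe_mul_eq_smul] using this
  have hX : partialX f (unitOf a) a.re ‖a.im‖ = 1 := by
    refine (HasFDerivAt.comp_hasDerivAt_of_eq a.re h ((hcoe a.re).add_const _)
      (re_add_unitOf_mul_norm a).symm).deriv.trans ?_
    simp
  have hY : partialY f (unitOf a) a.re ‖a.im‖ = unitOf a := by
    refine (HasFDerivAt.comp_hasDerivAt_of_eq ‖a.im‖ h (((hcoe ‖a.im‖).const_mul _).const_add _)
      (re_add_unitOf_mul_norm a).symm).deriv.trans ?_
    simp
  rw [cullenDeriv, hX, hY, unitOf_mul_self, sub_neg_eq_add, ← two_smul ℝ, smul_smul]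
  norm_num

theorem two_mul_im_eq_sub_star (q : ℍ[ℝ]) : 2 * q.im = q - star q := by
  have h : star q = (q.re : ℍ[ℝ]) - q.im := by
    conv_lhs => rw [← Quaternion.re_add_im q]
    rw [star_add, Quaternion.star_coe, Quaternion.star_im, sub_eq_add_neg]
  have e : q - star q = ((q.re : ℍ[ℝ]) + q.im) - ((q.re : ℍ[ℝ]) - q.im) := by
    rw [h, Quaternion.re_add_im]
  rw [e, two_mul]
  abel

theorem two_mul_im_ne_zero (h : q.im ≠ 0) : 2 * q.im ≠ 0 := by
  rw [two_mul, ← two_smul ℝ]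
  exact smul_ne_zero two_ne_zero h

end

end SliceRegular

end

/-! ### The equivalences -/

open SliceRegular in
theorem mainTheorem4 (f : ℍ[ℝ] → ℍ[ℝ])
    (hreg : SliceRegular.SliceRegularOn f SliceRegular.unitBall)
    (hmaps : Set.MapsTo f SliceRegular.unitBall SliceRegular.unitBall)
    (q₀ : ℍ[ℝ]) (hq₀ : q₀ ∈ SliceRegular.unitBall) (hfix : f q₀ = q₀) :
    List.TFAE
      [ Set.EqOn f id SliceRegular.unitBall,
        HasFDerivAt f (ContinuousLinearMap.id ℝ ℍ[ℝ]) q₀,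
        SliceRegular.cullenDeriv f q₀ = 1,
        SliceRegular.sphericalDeriv f q₀ = 1,
        ∃ q ∈ SliceRegular.unitBall,
          SliceRegular.diffQuotient f q₀ q =
            SliceRegular.leftQuotient
              (fun p => 1 - SliceRegular.regMul (fun _ => star q₀) (fun p => p) p)
              (fun p => 1 - SliceRegular.regMul (fun _ => star q₀) f p) q ] := by
  have ha : ‖q₀‖ < 1 := mem_unitBall.mp hq₀
  have has : ‖star q₀‖ < 1 := by rwa [norm_star]
  obtain ⟨F, hF⟩ := hreg.exists_hasPowerSeries
  obtain ⟨K, hK, hFK⟩ := exists_eq_X_sub_C_mul (hF.convergesOnBall.sub .X) ha (by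
    rw [twistedEval_sub hF.convergesOnBall .X ha, ← hF.eq_twistedEval ha, twistedEval_X, hfix,
      mul_one, sub_self])
  have h : F = X + (X - C q₀) * K := by rw [← hFK]; abel
  have hbound : ∀ p : ℍ[ℝ], ‖p‖ < 1 → ‖twistedEval F p 1‖ ≤ 1 := fun p hp => by
    rw [← hF.eq_twistedEval hp]
    exact (mem_unitBall.mp (hmaps (mem_unitBall.mpr hp))).le
  have hzero : ∀ p : ℍ[ℝ], ‖p‖ < 1 → twistedEval K p 1 = 0 → Set.EqOn f id unitBall := by
    intro p hp h0 q hq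
    have hq' := mem_unitBall.mp hq
    rw [hF.eq_twistedEval hq', h, eq_zero_of_twistedEval_eq_zero_of_bounded hK h hbound ha hp h0,
      mul_zero, add_zero, twistedEval_X, mul_one, id]
  tfae_have 1 → 2 := by
    intro h1
    exact (hasFDerivAt_id q₀).congr_of_eventuallyEq
      (h1.eventuallyEq_of_mem (Metric.isOpen_ball.mem_nhds hq₀))
  tfae_have 2 → 3 := cullenDeriv_eq_one_of_hasFDerivAt
  tfae_have 3 → 1 := by
    intro h3
    rw [hF.cullenDeriv_eq_one_add hK h ha] at h3
    exact hzero q₀ ha (by simpa using h3)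
  tfae_have 1 → 4 := by
    intro h1
    rw [sphericalDeriv]
    split_ifs with him
    · exact tfae_2_to_3 (tfae_1_to_2 h1)
    · rw [hfix, h1 (mem_unitBall.mpr has), id, ← two_mul_im_eq_sub_star]
      exact inv_mul_cancel₀ (two_mul_im_ne_zero him)
  tfae_have 4 → 1 := by
    intro h4
    rw [sphericalDeriv] at h4
    split_ifs at h4 with him
    · exact tfae_3_to_1 h4
    -- The condition reduces to `f(ā) = ā`, so `(ā - a) K(ā) = 0` with `ā ≠ a`.
    · have h2 : (2 : ℍ[ℝ]) * q₀.im ≠ 0 := two_mul_im_ne_zero him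
      rw [inv_mul_eq_one₀ h2, two_mul_im_eq_sub_star, hfix, sub_right_inj] at h4
      have hc : Commute q₀ (star q₀) := by
        rw [Commute, SemiconjBy, Quaternion.self_mul_star, Quaternion.star_mul_self]
      have h5 := hF.eq_add_sub_mul hK h has hc
      rw [← h4, left_eq_add] at h5
      refine hzero _ has ((mul_eq_zero.mp h5).resolve_left ?_)
      rw [← neg_sub, ← two_mul_im_eq_sub_star]
      exact neg_ne_zero.mpr h2
  tfae_have 1 → 5 := by
    intro h1
    -- For the identity the quotient can be taken to be `0`, and both sides of condition 5 equal
    -- `1`; the point `q₀` is an arbitrary choice.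
    have hK0 : F = X + (X - C q₀) * 0 := by
      rw [mul_zero, add_zero]
      ext1 n
      have hX : HasPowerSeries f X := .of_eq .X fun q hq => by
        rw [h1 (mem_unitBall.mpr hq), twistedEval_X, mul_one, id]
      exact congrFun (hF.unique hX) n
    have h0 : ConvergesOnBall 0 := by simpa using ConvergesOnBall.const 0
    refine ⟨q₀, hq₀, ?_⟩
    obtain ⟨S, -, hS⟩ := leftQuotient_eq hF ha h0 hK0 ha
    rw [diffQuotient_eq_one_add hF hfix h0 hK0 ha, hS]
    simp [twistedEval]
  tfae_have 5 → 1 := by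
    rintro ⟨q, hq, heq⟩
    obtain ⟨p, hp, hp0⟩ := exists_twistedEval_eq_zero hF ha hfix hK h (mem_unitBall.mp hq) heq
    exact hzero p hp hp0
  tfae_finish
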